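/- All graphs are finite and simple. For a graph $G$ with vertex set $V$, the chromatic symmetric function of $G$ is \[ X_G=\sum_{\kappa}\ \prod_{v\in V} x_{\kappa(v)} , \] a formal power series in the variables $x_1,x_2,x_3,\dots$, where the sum is over all proper colourings $\kappa:V\to\{1,2,3,\dots\}$, i.e. all maps with $\kappa(u)\neq\kappa(v)$ whenever $u$ and $v$ are adjacent. Let $e_n=\sum_{j_1<\cdots<j_n}x_{j_1}\cdots x_{j_n}$ and, for a partition $\lambda=(\lambda_1,\dots,\lambda_\ell)$, let $e_\lambda=e_{\lambda_1}\cdots e_{\lambda_\ell}$. A symmetric function is $e$-positive if it is a linear combination of the $e_\lambda$ with nonnegative coefficients. (For a symmetric function with integer coefficients, such as $X_G$, these coefficients are automatically integers.) The claw is $K_{1,3}$, the diamond is $K_4$ with one edge removed, and the co-claw and the co-diamond are the complements of the claw and of the diamond. A graph is $(H_1,\dots,H_k)$-free if none of its induced subgraphs is isomorphic to any of $H_1,\dots,H_k$. Theorem. If a graph $G$ is (claw, co-diamond, diamond)-free or (claw, co-diamond, co-claw)-free, then $X_G$ is $e$-positive. -/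

import Mathlib

open scoped SimpleGraph

namespace ChromSymm

/-! ### Four-vertex graphs -/

/-- The claw `K_{1,3}`: vertex `0` is joined to `1`, `2`, `3`. -/
def claw : SimpleGraph (Fin 4) :=
  SimpleGraph.fromEdgeSet {s(0, 1), s(0, 2), s(0, 3)}

/-- The diamond `K₄ - e`: all pairs of vertices except `{1, 3}` are edges. -/
def diamond : SimpleGraph (Fin 4) :=
  SimpleGraph.fromEdgeSet {s(0, 1), s(0, 2), s(0, 3), s(1, 2), s(2, 3)}

/-- The co-claw, the complement of the claw. -/
def coClaw : SimpleGraph (Fin 4) := clawᶜ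

/-- The co-diamond, the complement of the diamond. -/
def coDiamond : SimpleGraph (Fin 4) := diamondᶜ

/-- `G` is `H`-free: no induced subgraph of `G` is isomorphic to `H`. -/
def InducedFree {V W : Type*} (G : SimpleGraph V) (H : SimpleGraph W) : Prop :=
  ¬ H ⊴ G

/-! ### Symmetric functions in the variables `x₁, x₂, x₃, …` -/

/-- The formal sum `∑ i, x ^ (f i)` of monomials in the variables `x_j`, `j ∈ ℤ⁺`, for a family
`f` of exponent vectors: the coefficient at `m` is the number of indices `i` with `f i = m`.
It is used only for families in which every monomial occurs finitely often. -/
noncomputable def monomialSum {ι : Type*} (f : ι → ℕ+ →₀ ℕ) : MvPowerSeries ℕ+ ℤ :=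
  fun m => (Nat.card {i : ι // f i = m} : ℤ)

open scoped MvPowerSeries.WithPiTopology in
/-- If every monomial occurs finitely often in the family, then `monomialSum f` is indeed the sum
of the monomials `x ^ (f i)`, for coefficientwise convergence of power series. -/
theorem hasSum_monomialSum {ι : Type*} (f : ι → ℕ+ →₀ ℕ)
    (hf : ∀ m, {i : ι | f i = m}.Finite) :
    HasSum (fun i => MvPowerSeries.monomial (f i) (1 : ℤ)) (monomialSum f) := by
  classical
  refine Pi.hasSum.2 fun m => ?_
  have h : HasSum (fun i => if i ∈ (hf m).toFinset then (1 : ℤ) else 0)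
      (∑ i ∈ (hf m).toFinset, if i ∈ (hf m).toFinset then (1 : ℤ) else 0) :=
    hasSum_sum_of_ne_finset_zero fun i hi => if_neg hi
  convert h using 1
  · funext i
    have := MvPowerSeries.coeff_monomial (R := ℤ) m (f i) 1
    rw [MvPowerSeries.coeff_apply] at this
    rw [this]
    simp [eq_comm]
  · have : Nat.card {i : ι // f i = m} = (hf m).toFinset.card :=
      Nat.card_eq_card_finite_toFinset (hf m)
    have h2 : ∑ i ∈ (hf m).toFinset, (if i ∈ (hf m).toFinset then (1 : ℤ) else 0) =
        ∑ i ∈ (hf m).toFinset, (1 : ℤ) := Finset.sum_congr rfl fun i hi => if_pos hi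
    rw [h2, monomialSum, this]
    simp

/-- The exponent vector of the monomial `∏ v, x_{κ(v)}`. -/
noncomputable def colorExponent {V : Type*} [Fintype V] (κ : V → ℕ+) : ℕ+ →₀ ℕ :=
  ∑ v, Finsupp.single (κ v) 1

/-- The chromatic symmetric function `X_G = ∑ κ, ∏ v, x_{κ(v)}`, the sum being over all proper
colourings `κ` of `G` by positive integers. -/
noncomputable def chromaticSymm {V : Type*} [Fintype V] (G : SimpleGraph V) :
    MvPowerSeries ℕ+ ℤ :=
  monomialSum fun κ : G.Coloring ℕ+ => colorExponent κ

/-- Every monomial occurs only finitely often in `X_G`. -/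
theorem finite_coloring_fiber {V : Type*} [Fintype V] (G : SimpleGraph V) (m : ℕ+ →₀ ℕ) :
    {κ : G.Coloring ℕ+ | colorExponent κ = m}.Finite := by
  classical
  have h : (Set.pi Set.univ fun _ : V => (m.support : Set ℕ+)).Finite :=
    Set.Finite.pi fun _ => m.support.finite_toSet
  refine Set.Finite.of_finite_image (f := fun κ : G.Coloring ℕ+ => (κ : V → ℕ+))
    (h.subset ?_) DFunLike.coe_injective.injOn
  rintro _ ⟨κ, rfl, rfl⟩ v -
  have h1 : (1 : ℕ) ≤ ∑ w, (Finsupp.single (κ w) 1 : ℕ+ →₀ ℕ) (κ v) := by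
    refine le_trans ?_ (Finset.single_le_sum (fun _ _ => Nat.zero_le _) (Finset.mem_univ v))
    simp
  simp only [colorExponent, Finset.mem_coe, Finsupp.mem_support_iff, Finsupp.finsetSum_apply]
  omega

/-- The elementary symmetric function `e_n = ∑ x_{j₁} ⋯ x_{jₙ}`, the sum being over all
`j₁ < ⋯ < jₙ`, that is over all `n`-element sets of positive integers. -/
noncomputable def elemSymm (n : ℕ) : MvPowerSeries ℕ+ ℤ :=
  monomialSum fun s : {s : Finset ℕ+ // s.card = n} => ∑ j ∈ s.1, Finsupp.single j 1

/-- Every monomial occurs only finitely often (at most once) in `e_n`. -/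
theorem finite_elemSymm_fiber (n : ℕ) (m : ℕ+ →₀ ℕ) :
    {s : {s : Finset ℕ+ // s.card = n} |
      (∑ j ∈ s.1, Finsupp.single j 1 : ℕ+ →₀ ℕ) = m}.Finite := by
  classical
  have key (s : Finset ℕ+) (j : ℕ+) :
      (∑ i ∈ s, Finsupp.single i 1 : ℕ+ →₀ ℕ) j = if j ∈ s then 1 else 0 := by
    simp [Finsupp.finsetSum_apply, Finsupp.single_apply]
  refine Set.Subsingleton.finite ?_
  rintro s hs t ht
  refine Subtype.ext (Finset.ext fun j => ?_)
  have h := DFunLike.congr_fun (hs.trans ht.symm) j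
  rw [key, key] at h
  by_cases h1 : j ∈ s.1 <;> by_cases h2 : j ∈ t.1 <;> simp_all

/-- `e_λ = e_{λ₁} e_{λ₂} ⋯ e_{λ_ℓ}` for a partition `λ`. -/
noncomputable def elemSymmPart {n : ℕ} (p : n.Partition) : MvPowerSeries ℕ+ ℤ :=
  (p.parts.map elemSymm).prod

/-- A symmetric function is `e`-positive if it is a (finite) linear combination of the `e_λ` with
nonnegative coefficients. The `e_λ` are a `ℤ`-basis of the symmetric functions with integer
coefficients, so for these it is the same to ask for nonnegative integer coefficients. -/
def IsEPositive (F : MvPowerSeries ℕ+ ℤ) : Prop :=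
  ∃ c : (Σ n : ℕ, n.Partition) →₀ ℤ,
    (∀ p, 0 ≤ c p) ∧ F = c.sum fun p a => a • elemSymmPart p.2

end ChromSymm

/-! Everything is read in the complement `H` of `G`, where stable sets of `G` become cliques.
Claw-freeness says that every vertex outside a triangle of `H` is adjacent to one of its vertices,
and co-diamond-freeness says that `H` is diamond-free. The third forbidden graph, whichever it is,
is used only to show that two vertices whose sole neighbour in a given triangle is the same vertex
are adjacent (`IsTriangleDominated`). Three cases remain.

If `H` contains `K₄`, domination and diamond-freeness force `H` to be complete, so `G` has no edges
and `X_G` is a power of `e_1`.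

If `H` has no triangle, `X_G` is a combination of products `e_k e_{n-k}`: one sums over sequences of
`k` disjoint stable pairs, weighted by the number of acyclic orientations with a single sink on the
remaining vertices. These weights are defined by recursion, and their nonnegativity is proved by
refining them by the position of the sink (`sinkAtCount_nonneg_aux`).

If `H` has a triangle but no `K₄`, every other vertex is adjacent to exactly one vertex of the
triangle. Each triangle vertex together with its private neighbours is a clique, so it has at most
two of them, and adjacency between these cliques is a matching pattern determined up to one bit.
Hence `H` is an induced subgraph, containing the triangle, of one of two graphs on nine vertices
(`exists_grid_labelling`). The finitely many resulting expansions in products `e_a e_b e_c` are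
computed and verified by the kernel (`gridCheck_eq_true`).

Identities with `X_G` are proved by removing one variable, that is one colour class, at a time: a
family of series indexed by vertex sets is the family of chromatic symmetric functions once it has
the right constant terms and the right coefficients of `x_j ^ k`
(`IsChromaticFamily.eq_chromaticSymm`). -/

namespace ChromSymm

/-! ### Extracting the coefficient of a power of one variable -/

/-- The coefficient of `x_j ^ k` in a power series, as a power series not involving `x_j`. -/
noncomputable def colorCoeff (j : ℕ+) (k : ℕ) (F : MvPowerSeries ℕ+ ℤ) : MvPowerSeries ℕ+ ℤ :=
  fun m => if m j = 0 then F (m + Finsupp.single j k) else 0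

/-- This reduces a coefficient at `m` to one at a monomial with fewer variables, the step of every
induction over the variables below. -/
theorem colorCoeff_apply_erase (j : ℕ+) (F : MvPowerSeries ℕ+ ℤ) (m : ℕ+ →₀ ℕ) :
    colorCoeff j (m j) F (m.erase j) = F m := by
  simp [colorCoeff, Finsupp.erase_add_single]

theorem colorCoeff_zero_apply_erase (j : ℕ+) (F : MvPowerSeries ℕ+ ℤ) (m : ℕ+ →₀ ℕ) :
    colorCoeff j 0 F (m.erase j) = F (m.erase j) := by
  simp [colorCoeff]

@[simp]
theorem colorCoeff_zero_series (j : ℕ+) (k : ℕ) : colorCoeff j k 0 = 0 := by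
  funext m
  by_cases h : m j = 0 <;> simp [colorCoeff, h] <;> rfl

theorem colorCoeff_add (j : ℕ+) (k : ℕ) (F G : MvPowerSeries ℕ+ ℤ) :
    colorCoeff j k (F + G) = colorCoeff j k F + colorCoeff j k G := by
  funext m
  change (if _ then F _ + G _ else 0) = (if _ then F _ else 0) + (if _ then G _ else 0)
  split_ifs <;> simp

/-- `colorCoeff` as an additive map. -/
noncomputable def colorCoeffHom (j : ℕ+) (k : ℕ) :
    MvPowerSeries ℕ+ ℤ →+ MvPowerSeries ℕ+ ℤ where
  toFun := colorCoeff j k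
  map_zero' := colorCoeff_zero_series j k
  map_add' := colorCoeff_add j k

theorem colorCoeff_sum {ι : Type*} (j : ℕ+) (k : ℕ) (s : Finset ι)
    (F : ι → MvPowerSeries ℕ+ ℤ) :
    colorCoeff j k (∑ i ∈ s, F i) = ∑ i ∈ s, colorCoeff j k (F i) :=
  map_sum (colorCoeffHom j k) F s

theorem colorCoeff_smul (j : ℕ+) (k : ℕ) (c : ℤ) (F : MvPowerSeries ℕ+ ℤ) :
    colorCoeff j k (c • F) = c • colorCoeff j k F :=
  map_zsmul (colorCoeffHom j k) c F

/-- If `m` does not involve `x_j`, splitting `m + k·j` into two exponents is the same as splitting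
`k` and `m` independently. If it does, one factor of every term would have to involve `x_j`, and
both sides vanish. -/
theorem colorCoeff_mul (j : ℕ+) (k : ℕ) (F G : MvPowerSeries ℕ+ ℤ) :
    colorCoeff j k (F * G) =
      ∑ p ∈ Finset.HasAntidiagonal.antidiagonal k, colorCoeff j p.1 F * colorCoeff j p.2 G := by
  classical
  ext m
  rw [map_sum]
  simp only [MvPowerSeries.coeff_mul]
  by_cases hm : m j = 0
  · have h1 : MvPowerSeries.coeff m (colorCoeff j k (F * G)) =
        MvPowerSeries.coeff (m + Finsupp.single j k) (F * G) := by
      simp [MvPowerSeries.coeff_apply, colorCoeff, hm]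
    rw [h1, MvPowerSeries.coeff_mul, ← Finset.sum_product']
    refine Finset.sum_bij' (fun q _ => ((q.1 j, q.2 j), (q.1.erase j, q.2.erase j)))
      (fun q _ => (q.2.1 + Finsupp.single j q.1.1, q.2.2 + Finsupp.single j q.1.2)) ?_ ?_ ?_ ?_ ?_
    · intro q hq
      rw [Finset.HasAntidiagonal.mem_antidiagonal] at hq
      simp only [Finset.mem_product, Finset.HasAntidiagonal.mem_antidiagonal]
      constructor
      · have := DFunLike.congr_fun hq j
        simpa [hm] using this
      · ext i
        have := DFunLike.congr_fun hq i
        by_cases hi : i = j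
        · subst hi; simp [hm]
        · simpa [hi, Ne.symm hi, Finsupp.single_apply] using this
    · intro q hq
      simp only [Finset.mem_product, Finset.HasAntidiagonal.mem_antidiagonal] at hq ⊢
      rw [← hq.1, ← hq.2, Finsupp.single_add]
      abel
    · intro q hq
      simp [Finsupp.erase_add_single]
    · intro q hq
      simp only [Finset.mem_product, Finset.HasAntidiagonal.mem_antidiagonal] at hq
      have h0 := DFunLike.congr_fun hq.2 j
      simp only [Finsupp.coe_add, Pi.add_apply, hm, Nat.add_eq_zero_iff] at h0
      simp [h0.1, h0.2, Finsupp.erase_add]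
    · intro q hq
      simp only [MvPowerSeries.coeff_apply, colorCoeff_apply_erase]
  · have h1 : MvPowerSeries.coeff m (colorCoeff j k (F * G)) = 0 := by
      simp [MvPowerSeries.coeff_apply, colorCoeff, hm]
    rw [h1, eq_comm]
    refine Finset.sum_eq_zero fun p _ => Finset.sum_eq_zero fun q hq => ?_
    rw [Finset.HasAntidiagonal.mem_antidiagonal] at hq
    have := DFunLike.congr_fun hq j
    simp only [Finsupp.coe_add, Pi.add_apply] at this
    rcases Nat.eq_zero_or_pos (q.1 j) with h | h
    · have : q.2 j ≠ 0 := by omega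
      simp [MvPowerSeries.coeff_apply, colorCoeff, this]
    · have : q.1 j ≠ 0 := by omega
      simp [MvPowerSeries.coeff_apply, colorCoeff, this]

theorem colorCoeff_zero_mul (j : ℕ+) (F G : MvPowerSeries ℕ+ ℤ) :
    colorCoeff j 0 (F * G) = colorCoeff j 0 F * colorCoeff j 0 G := by
  simp [colorCoeff_mul]

/-! ### Elementary symmetric functions -/

open Classical in
theorem elemSymm_apply (n : ℕ) (m : ℕ+ →₀ ℕ) :
    elemSymm n m = if (∀ i, m i ≤ 1) ∧ m.support.card = n then 1 else 0 := by
  classical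
  have key (s : Finset ℕ+) (j : ℕ+) :
      (∑ i ∈ s, Finsupp.single i 1 : ℕ+ →₀ ℕ) j = if j ∈ s then 1 else 0 := by
    simp [Finsupp.finsetSum_apply, Finsupp.single_apply]
  have hsub : Subsingleton {s : {s : Finset ℕ+ // s.card = n} //
      (∑ j ∈ s.1, Finsupp.single j 1 : ℕ+ →₀ ℕ) = m} := by
    refine ⟨fun ⟨s, hs⟩ ⟨t, ht⟩ => Subtype.ext (Subtype.ext (Finset.ext fun j => ?_))⟩
    have h := DFunLike.congr_fun (hs.trans ht.symm) j
    rw [key, key] at h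
    by_cases h1 : j ∈ s.1 <;> by_cases h2 : j ∈ t.1 <;> simp_all
  unfold elemSymm monomialSum
  split_ifs with h
  · have : Nonempty {s : {s : Finset ℕ+ // s.card = n} //
        (∑ j ∈ s.1, Finsupp.single j 1 : ℕ+ →₀ ℕ) = m} := by
      refine ⟨⟨⟨m.support, h.2⟩, Finsupp.ext fun j => ?_⟩⟩
      rw [key]
      have := h.1 j
      split_ifs with h1
      · rw [Finsupp.mem_support_iff] at h1; omega
      · rw [Finsupp.notMem_support_iff] at h1; exact h1.symm
    exact_mod_cast Nat.card_unique
  · have : IsEmpty {s : {s : Finset ℕ+ // s.card = n} //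
        (∑ j ∈ s.1, Finsupp.single j 1 : ℕ+ →₀ ℕ) = m} := by
      refine ⟨fun ⟨s, hs⟩ => h ⟨fun i => ?_, ?_⟩⟩
      · rw [← hs, key]; split_ifs <;> omega
      · have : m.support = s.1 := by
          ext j
          rw [Finsupp.mem_support_iff, ← hs, key]
          simp
        rw [this, s.2]
    exact_mod_cast Nat.card_of_isEmpty

theorem elemSymm_zero : elemSymm 0 = 1 := by
  classical
  funext m
  have h1 : (1 : MvPowerSeries ℕ+ ℤ) m = if m = 0 then 1 else 0 := by
    have := MvPowerSeries.coeff_one (σ := ℕ+) (R := ℤ) (n := m)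
    rwa [MvPowerSeries.coeff_apply] at this
  rw [h1, elemSymm_apply]
  refine if_congr ⟨fun h => ?_, fun h => ?_⟩ rfl rfl
  · simpa using h.2
  · simp [h]

/-- The elementary symmetric functions with the index shifted by one, so that
`shiftedElem 0 = 0` plays the role of `e_{-1}`. -/
noncomputable def shiftedElem : ℕ → MvPowerSeries ℕ+ ℤ
  | 0 => 0
  | a + 1 => elemSymm a

/-- Removing `x_j` from a squarefree monomial lowers its degree by one. Truncated subtraction is
harmless at `a = 0`, since index `0` denotes the zero series. -/
theorem colorCoeff_shiftedElem_one (j : ℕ+) (a : ℕ) :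
    colorCoeff j 1 (shiftedElem a) = colorCoeff j 0 (shiftedElem (a - 1)) := by
  classical
  funext m
  by_cases hm : m j = 0
  swap
  · simp [colorCoeff, hm]
  simp only [colorCoeff, hm, if_true, Finsupp.single_zero, add_zero]
  have hcard : (m + Finsupp.single j 1).support.card = m.support.card + 1 := by
    rw [Finsupp.support_add_eq, Finsupp.support_single _ one_ne_zero,
      Finset.card_union_of_disjoint, Finset.card_singleton]
    all_goals simp [hm]
  have hle : (∀ i, (m + Finsupp.single j 1 : ℕ+ →₀ ℕ) i ≤ 1) ↔ ∀ i, m i ≤ 1 := by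
    refine forall_congr' fun i => ?_
    by_cases hi : i = j
    · subst hi; simp [hm]
    · simp [Ne.symm hi]
  match a with
  | 0 => rfl
  | 1 =>
    change elemSymm 0 _ = 0
    rw [elemSymm_apply, if_neg]
    rw [hcard]; omega
  | a + 2 =>
    change elemSymm (a + 1) _ = elemSymm a _
    rw [elemSymm_apply, elemSymm_apply, hle, hcard]
    simp

theorem colorCoeff_shiftedElem_of_two_le (j : ℕ+) (a k : ℕ) (hk : 2 ≤ k) :
    colorCoeff j k (shiftedElem a) = 0 := by
  funext m
  change (if m j = 0 then shiftedElem a (m + Finsupp.single j k) else 0) = 0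
  split_ifs with hm
  · match a with
    | 0 => rfl
    | a + 1 =>
      change elemSymm a _ = 0
      rw [elemSymm_apply, if_neg]
      intro h
      have := h.1 j
      simp [hm] at this
      omega
  · rfl

theorem colorCoeff_mul_shiftedElem (j : ℕ+) (k a : ℕ) (F : MvPowerSeries ℕ+ ℤ) :
    colorCoeff j (k + 1) (F * shiftedElem a) =
      colorCoeff j (k + 1) F * colorCoeff j 0 (shiftedElem a) +
        colorCoeff j k F * colorCoeff j 0 (shiftedElem (a - 1)) := by
  rw [colorCoeff_mul, Finset.Nat.sum_antidiagonal_eq_sum_range_succ_mk, Finset.sum_range_succ,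
    Finset.sum_range_succ, Finset.sum_eq_zero]
  · simp [colorCoeff_shiftedElem_one, add_comm]
  · intro i hi
    rw [Finset.mem_range] at hi
    simp only
    rw [colorCoeff_shiftedElem_of_two_le _ _ _ (by omega), mul_zero]

theorem colorCoeff_pair_one (j : ℕ+) (a b : ℕ) :
    colorCoeff j 1 (shiftedElem a * shiftedElem b) =
      colorCoeff j 0 (shiftedElem (a - 1) * shiftedElem b + shiftedElem a * shiftedElem (b - 1)) := by
  rw [colorCoeff_mul_shiftedElem j 0, colorCoeff_shiftedElem_one, colorCoeff_add,
    colorCoeff_zero_mul, colorCoeff_zero_mul]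

theorem colorCoeff_pair_two (j : ℕ+) (a b : ℕ) :
    colorCoeff j 2 (shiftedElem a * shiftedElem b) =
      colorCoeff j 0 (shiftedElem (a - 1) * shiftedElem (b - 1)) := by
  rw [colorCoeff_mul_shiftedElem j 1, colorCoeff_shiftedElem_one,
    colorCoeff_shiftedElem_of_two_le _ _ _ (by omega), zero_mul, zero_add, colorCoeff_zero_mul]

theorem colorCoeff_pair_of_three_le (j : ℕ+) (a b k : ℕ) (hk : 3 ≤ k) :
    colorCoeff j k (shiftedElem a * shiftedElem b) = 0 := by
  obtain ⟨k, rfl⟩ : ∃ l, k = l + 1 := ⟨k - 1, by omega⟩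
  rw [colorCoeff_mul_shiftedElem, colorCoeff_shiftedElem_of_two_le _ _ (k + 1) (by omega),
    colorCoeff_shiftedElem_of_two_le _ _ k (by omega), zero_mul, zero_mul, zero_add]

/-! ### `e`-positivity -/

theorem isEPositive_zero : IsEPositive 0 := ⟨0, fun _ => le_rfl, by simp⟩

theorem IsEPositive.add {F G : MvPowerSeries ℕ+ ℤ} (hF : IsEPositive F) (hG : IsEPositive G) :
    IsEPositive (F + G) := by
  classical
  obtain ⟨c, hc, rfl⟩ := hF
  obtain ⟨d, hd, rfl⟩ := hG
  refine ⟨c + d, fun p => add_nonneg (hc p) (hd p), ?_⟩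
  rw [Finsupp.sum_add_index'] <;> simp [add_smul]

theorem IsEPositive.sum {ι : Type*} (s : Finset ι) {F : ι → MvPowerSeries ℕ+ ℤ}
    (h : ∀ i ∈ s, IsEPositive (F i)) : IsEPositive (∑ i ∈ s, F i) :=
  Finset.sum_induction F IsEPositive (fun _ _ => IsEPositive.add) isEPositive_zero h

theorem IsEPositive.smul {F : MvPowerSeries ℕ+ ℤ} (hF : IsEPositive F) {a : ℤ} (ha : 0 ≤ a) :
    IsEPositive (a • F) := by
  obtain ⟨c, hc, rfl⟩ := hF
  refine ⟨a • c, fun p => mul_nonneg ha (hc p), ?_⟩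
  rw [Finsupp.sum_smul_index (by simp), Finsupp.sum, Finsupp.sum, Finset.smul_sum]
  simp [mul_smul]

/-- Zero entries are not parts of a partition, but they contribute only factors `e_0 = 1` and can be
dropped. -/
theorem isEPositive_prod_elemSymm (s : Multiset ℕ) : IsEPositive (s.map elemSymm).prod := by
  classical
  refine ⟨Finsupp.single ⟨s.sum, Nat.Partition.ofSums s.sum s rfl⟩ 1, fun p => ?_, ?_⟩
  · rw [Finsupp.single_apply]; split_ifs <;> simp
  · rw [Finsupp.sum_single_index (by simp), one_smul, elemSymmPart, Nat.Partition.ofSums_parts]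
    rw [← Multiset.filter_add_not (fun x => x ≠ 0) s, Multiset.map_add, Multiset.prod_add]
    have : ((s.filter fun x => ¬ x ≠ 0).map elemSymm).prod = 1 := by
      refine Multiset.prod_eq_one fun x hx => ?_
      obtain ⟨y, hy, rfl⟩ := Multiset.mem_map.1 hx
      have : y = 0 := by simpa using (Multiset.mem_filter.1 hy).2
      rw [this, elemSymm_zero]
    rw [this, mul_one]
    simp

theorem isEPositive_elemSymm_mul (a b : ℕ) : IsEPositive (elemSymm a * elemSymm b) := by
  simpa using isEPositive_prod_elemSymm {a, b}

theorem isEPositive_elemSymm_mul_mul (a b c : ℕ) :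
    IsEPositive (elemSymm a * elemSymm b * elemSymm c) := by
  simpa [mul_assoc] using isEPositive_prod_elemSymm {a, b, c}

/-! ### Counting proper colourings one colour class at a time -/

section Count

variable {V : Type*} [DecidableEq V]

open Classical in
/-- The stable subsets of `S` with `k` elements. -/
noncomputable def stable (G : SimpleGraph V) (k : ℕ) (S : Finset V) : Finset (Finset V) :=
  (S.powersetCard k).filter fun I => G.IsIndepSet I

theorem mem_stable {G : SimpleGraph V} {k : ℕ} {S I : Finset V} :
    I ∈ stable G k S ↔ I ⊆ S ∧ I.card = k ∧ G.IsIndepSet I := by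
  simp [stable, Finset.mem_powersetCard, and_assoc]

/-- The number of proper colourings of `G[S]` with colour classes of prescribed sizes. -/
noncomputable def count (G : SimpleGraph V) : List ℕ → Finset V → ℕ
  | [], S => if S = ∅ then 1 else 0
  | k :: L, S => ∑ I ∈ stable G k S, count G L (S \ I)

/-- `A j` is the class of colour `j` in a proper colouring of `G[S]` with content `m`. -/
structure IsColorClasses (G : SimpleGraph V) (S : Finset V) (m : ℕ+ →₀ ℕ)
    (A : ℕ+ → Finset V) : Prop where
  mem_iff : ∀ v, v ∈ S ↔ ∃ j, v ∈ A j
  unique : ∀ v j k, v ∈ A j → v ∈ A k → j = k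
  card : ∀ j, (A j).card = m j
  indep : ∀ j, G.IsIndepSet (A j)

/-- Splitting off the class of colour `j`. -/
noncomputable def splitColorClass (G : SimpleGraph V) (S : Finset V) (m : ℕ+ →₀ ℕ) (j : ℕ+) :
    {A // IsColorClasses G S m A} ≃
      Σ I : stable G (m j) S, {A // IsColorClasses G (S \ I) (m.erase j) A} where
  toFun A := ⟨⟨A.1 j, mem_stable.2 ⟨fun v hv => (A.2.mem_iff v).2 ⟨j, hv⟩, A.2.card j, A.2.indep j⟩⟩,
    Function.update A.1 j ∅, by
      obtain ⟨A, hA⟩ := A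
      refine ⟨fun v => ?_, fun v k l hk hl => ?_, fun k => ?_, fun k => ?_⟩
      · simp only [Finset.mem_sdiff, hA.mem_iff v]
        constructor
        · rintro ⟨⟨k, hk⟩, hj⟩
          refine ⟨k, ?_⟩
          have : k ≠ j := fun h => hj (h ▸ hk)
          simpa [Function.update_of_ne this] using hk
        · rintro ⟨k, hk⟩
          have : k ≠ j := by rintro rfl; simp at hk
          rw [Function.update_of_ne this] at hk
          exact ⟨⟨k, hk⟩, fun hj => this (hA.unique v k j hk hj)⟩
      · have h1 : k ≠ j := by rintro rfl; simp at hk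
        have h2 : l ≠ j := by rintro rfl; simp at hl
        rw [Function.update_of_ne h1] at hk
        rw [Function.update_of_ne h2] at hl
        exact hA.unique v k l hk hl
      · by_cases h : k = j
        · subst h; simp
        · simp [h, hA.card]
      · by_cases h : k = j
        · subst h; simp
        · simpa [h] using hA.indep k⟩
  invFun p := ⟨Function.update p.2.1 j p.1.1, by
      obtain ⟨⟨I, hI⟩, ⟨A, hA⟩⟩ := p
      obtain ⟨hIS, hIc, hIi⟩ := mem_stable.1 hI
      -- The erased content has exponent `0` at `j`, so the slot for the class of colour `j` is
      -- free.
      have hAj : A j = ∅ := by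
        have := hA.card j
        simpa using this
      have hdis : ∀ v k, v ∈ A k → v ∉ I := fun v k hk =>
        (Finset.mem_sdiff.1 ((hA.mem_iff v).2 ⟨k, hk⟩)).2
      refine ⟨fun v => ?_, fun v k l hk hl => ?_, fun k => ?_, fun k => ?_⟩
      · constructor
        · intro hv
          by_cases hvI : v ∈ I
          · exact ⟨j, by simpa using hvI⟩
          · obtain ⟨k, hk⟩ := (hA.mem_iff v).1 (Finset.mem_sdiff.2 ⟨hv, hvI⟩)
            have : k ≠ j := by rintro rfl; simp [hAj] at hk
            exact ⟨k, by simpa [this] using hk⟩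
        · rintro ⟨k, hk⟩
          by_cases h : k = j
          · subst h
            exact hIS (by simpa using hk)
          · rw [Function.update_of_ne h] at hk
            exact (Finset.mem_sdiff.1 ((hA.mem_iff v).2 ⟨k, hk⟩)).1
      · by_cases h1 : k = j <;> by_cases h2 : l = j
        · rw [h1, h2]
        · subst h1
          rw [Function.update_self] at hk
          rw [Function.update_of_ne h2] at hl
          exact absurd hk (hdis v l hl)
        · subst h2
          rw [Function.update_self] at hl
          rw [Function.update_of_ne h1] at hk
          exact absurd hl (hdis v k hk)
        · rw [Function.update_of_ne h1] at hk
          rw [Function.update_of_ne h2] at hl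
          exact hA.unique v k l hk hl
      · by_cases h : k = j
        · subst h; simpa using hIc
        · simp [h, hA.card]
      · by_cases h : k = j
        · subst h; simpa using hIi
        · simpa [h] using hA.indep k⟩
  left_inv A := by simp
  right_inv p := by
    obtain ⟨⟨I, hI⟩, ⟨A, hA⟩⟩ := p
    have hAj : A j = ∅ := by
      have := hA.card j
      simpa using this
    have h1 : Function.update A j ∅ = A := by rw [← hAj]; simp
    simp only [Function.update_idem]
    refine Sigma.ext (by simp) ?_
    simp only
    congr! 1
    · simp

/-- Induction on the list of colours through `splitColorClass`. Finiteness is carried along because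
`Nat.card_sigma` needs it for each fibre. -/
theorem card_colorClasses (G : SimpleGraph V) (js : List ℕ+) (hjs : js.Nodup) (S : Finset V)
    (m : ℕ+ →₀ ℕ) (hm : ∀ j, m j ≠ 0 → j ∈ js) :
    Finite {A // IsColorClasses G S m A} ∧
      Nat.card {A // IsColorClasses G S m A} = count G (js.map m) S := by
  induction js generalizing S m with
  | nil =>
    have hm0 : m = 0 := Finsupp.ext fun j => by
      by_contra h
      simpa using hm j h
    subst hm0
    have hA : ∀ A, IsColorClasses G S 0 A → A = fun _ => ∅ := fun A hA => funext fun j => by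
      simpa using hA.card j
    have hsub : Subsingleton {A // IsColorClasses G S 0 A} :=
      ⟨fun A B => Subtype.ext ((hA _ A.2).trans (hA _ B.2).symm)⟩
    refine ⟨inferInstance, ?_⟩
    simp only [List.map_nil, count]
    split_ifs with h
    · have : Nonempty {A // IsColorClasses G S 0 A} :=
        ⟨⟨fun _ => ∅, by simp [h], by simp, by simp, by simp⟩⟩
      exact Nat.card_unique
    · have : IsEmpty {A // IsColorClasses G S 0 A} := by
        refine ⟨fun A => h ?_⟩
        ext v
        rw [A.2.mem_iff, hA _ A.2]
        simp
      exact Nat.card_of_isEmpty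
  | cons j js ih =>
    rw [List.nodup_cons] at hjs
    have hm' : ∀ k, m.erase j k ≠ 0 → k ∈ js := fun k hk => by
      have hkj : k ≠ j := by rintro rfl; simp at hk
      rw [Finsupp.erase_ne hkj] at hk
      simpa [hkj] using hm k hk
    have hmap : js.map (m.erase j) = js.map m := List.map_congr_left fun k hk =>
      Finsupp.erase_ne (by rintro rfl; exact hjs.1 hk)
    have hfin : ∀ I : stable G (m j) S, Finite {A // IsColorClasses G (S \ I) (m.erase j) A} :=
      fun I => (ih hjs.2 _ _ hm').1
    refine ⟨Finite.of_equiv _ (splitColorClass G S m j).symm, ?_⟩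
    rw [Nat.card_congr (splitColorClass G S m j), Nat.card_sigma]
    simp only [(ih hjs.2 _ _ hm').2, hmap, List.map_cons, count]
    exact Finset.sum_coe_sort (stable G (m j) S) fun I => count G (js.map m) (S \ I)

/-- Colourings with content `m` are the same as families of colour classes. -/
noncomputable def coloringEquiv [Fintype V] (G : SimpleGraph V) (m : ℕ+ →₀ ℕ) :
    {κ : G.Coloring ℕ+ // colorExponent κ = m} ≃ {A // IsColorClasses G Finset.univ m A} where
  toFun κ := ⟨fun j => Finset.univ.filter fun v => κ.1 v = j, by
    obtain ⟨κ, rfl⟩ := κ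
    refine ⟨by simp, fun v j k hj hk => ?_, fun j => ?_, fun j u hu v hv _ huv => ?_⟩
    · simp only [Finset.mem_filter] at hj hk
      exact hj.2.symm.trans hk.2
    · simp [colorExponent, Finsupp.finsetSum_apply, Finsupp.single_apply]
    · simp only [Finset.coe_filter, Finset.mem_univ, true_and, Set.mem_ofPred_eq] at hu hv
      exact κ.valid huv (hu.trans hv.symm)⟩
  invFun A := ⟨SimpleGraph.Coloring.mk (fun v => ((A.2.mem_iff v).1 (Finset.mem_univ v)).choose) (by
      intro u v huv h
      have hu := ((A.2.mem_iff u).1 (Finset.mem_univ u)).choose_spec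
      have hv := ((A.2.mem_iff v).1 (Finset.mem_univ v)).choose_spec
      rw [← h] at hv
      exact A.2.indep _ hu hv huv.ne huv), by
    ext j
    rw [← A.2.card j]
    simp only [colorExponent, Finsupp.finsetSum_apply, Finsupp.single_apply]
    rw [← Finset.card_filter]
    congr 1
    ext v
    have hv := ((A.2.mem_iff v).1 (Finset.mem_univ v)).choose_spec
    simp only [Finset.mem_filter, Finset.mem_univ, true_and]
    exact ⟨fun h => h ▸ hv, fun h => A.2.unique v _ _ hv h⟩⟩
  left_inv κ := by
    refine Subtype.ext (DFunLike.ext _ _ fun v => ?_)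
    have hv := (((by simp : ∃ j, v ∈ Finset.univ.filter fun v => κ.1 v = j))).choose_spec
    exact (Finset.mem_filter.1 hv).2.symm
  right_inv A := by
    refine Subtype.ext (funext fun j => ?_)
    ext v
    have hv := ((A.2.mem_iff v).1 (Finset.mem_univ v)).choose_spec
    simp only [Finset.mem_filter, Finset.mem_univ, true_and]
    exact ⟨fun h => h ▸ hv, fun h => A.2.unique v _ _ hv h⟩

theorem chromaticSymm_apply [Fintype V] (G : SimpleGraph V) (js : List ℕ+) (hjs : js.Nodup)
    (m : ℕ+ →₀ ℕ) (hm : ∀ j, m j ≠ 0 → j ∈ js) :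
    chromaticSymm G m = count G (js.map m) Finset.univ := by
  unfold chromaticSymm monomialSum
  rw [← (card_colorClasses G js hjs Finset.univ m hm).2]
  exact_mod_cast Nat.card_congr (coloringEquiv G m)

/-- A family of power series satisfying the recursion of the chromatic symmetric functions of the
induced subgraphs, one colour class at a time. -/
structure IsChromaticFamily (G : SimpleGraph V) (E : Finset V → MvPowerSeries ℕ+ ℤ) : Prop where
  const : ∀ S, E S 0 = if S = ∅ then 1 else 0
  colorCoeff : ∀ S j k, 1 ≤ k →
    colorCoeff j k (E S) = colorCoeff j 0 (∑ I ∈ stable G k S, E (S \ I))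

/-- The recursion determines every coefficient: peeling off the variables of `m` one by one ends at
the constant term. It is assumed for `k ≥ 1` only, so the list has to be exactly the support of `m`.
-/
theorem IsChromaticFamily.apply {G : SimpleGraph V} {E : Finset V → MvPowerSeries ℕ+ ℤ}
    (hE : IsChromaticFamily G E) (js : List ℕ+) (hjs : js.Nodup) (S : Finset V)
    (m : ℕ+ →₀ ℕ) (hm : ∀ j, j ∈ js ↔ m j ≠ 0) : E S m = count G (js.map m) S := by
  induction js generalizing S m with
  | nil =>
    have hm0 : m = 0 := Finsupp.ext fun j => by
      by_contra h
      simpa using (hm j).2 h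
    subst hm0
    simp [count, hE.const]
  | cons j js ih =>
    rw [List.nodup_cons] at hjs
    have hm' : ∀ k, k ∈ js ↔ m.erase j k ≠ 0 := fun k => by
      by_cases hkj : k = j
      · subst hkj; simpa using hjs.1
      · rw [Finsupp.erase_ne hkj, ← hm k]
        simp [hkj]
    have hmap : js.map (m.erase j) = js.map m := List.map_congr_left fun k hk =>
      Finsupp.erase_ne (by rintro rfl; exact hjs.1 hk)
    have hj : 1 ≤ m j := Nat.one_le_iff_ne_zero.2 ((hm j).1 (by simp))
    rw [← colorCoeff_apply_erase j (E S) m, hE.colorCoeff S j _ hj, colorCoeff_zero_apply_erase]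
    have : (∑ I ∈ stable G (m j) S, E (S \ I)) (m.erase j) =
        ∑ I ∈ stable G (m j) S, E (S \ I) (m.erase j) := by
      simp only [← MvPowerSeries.coeff_apply, map_sum]
    rw [this, List.map_cons, count, Nat.cast_sum]
    exact Finset.sum_congr rfl fun I _ => by rw [ih hjs.2 _ _ hm', hmap]

theorem IsChromaticFamily.eq_chromaticSymm [Fintype V] {G : SimpleGraph V}
    {E : Finset V → MvPowerSeries ℕ+ ℤ} (hE : IsChromaticFamily G E) :
    E Finset.univ = chromaticSymm G := by
  funext m
  rw [hE.apply m.support.toList m.support.nodup_toList _ m (by simp),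
    chromaticSymm_apply G m.support.toList m.support.nodup_toList m (by simp)]

end Count

/-! ### Graphs without stable sets of size three -/

section PairSeries

variable {V : Type*} [DecidableEq V]

/-- Both sides run over the ordered pairs of disjoint stable subsets of sizes `a` and `b`. -/
theorem stable_sdiff_comm {M : Type*} [AddCommMonoid M] (G : SimpleGraph V) (a b : ℕ)
    (S : Finset V) (F : Finset V → M) :
    ∑ I ∈ stable G a S, ∑ J ∈ stable G b (S \ I), F ((S \ I) \ J) =
      ∑ J ∈ stable G b S, ∑ I ∈ stable G a (S \ J), F ((S \ J) \ I) := by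
  have : ∀ I J : Finset V, I ∈ stable G a S ∧ J ∈ stable G b (S \ I) ↔
      I ∈ stable G a (S \ J) ∧ J ∈ stable G b S := by
    intro I J
    simp only [mem_stable, Finset.subset_sdiff, disjoint_comm (a := I)]
    tauto
  rw [Finset.sum_comm' this]
  exact Finset.sum_congr rfl fun J _ => Finset.sum_congr rfl fun I _ => by
    rw [sdiff_right_comm]

theorem sum_stable_one {M : Type*} [AddCommMonoid M] (G : SimpleGraph V) (S : Finset V)
    (F : Finset V → M) : ∑ I ∈ stable G 1 S, F I = ∑ v ∈ S, F {v} := by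
  have : stable G 1 S = S.map ⟨fun v => {v}, Finset.singleton_injective⟩ := by
    ext I
    simp only [mem_stable, Finset.card_eq_one, Finset.mem_map, Function.Embedding.coeFn_mk]
    constructor
    · rintro ⟨h, ⟨v, rfl⟩, -⟩
      exact ⟨v, by simpa using h, rfl⟩
    · rintro ⟨v, hv, rfl⟩
      exact ⟨by simpa using hv, ⟨v, rfl⟩, by simp [SimpleGraph.IsIndepSet]⟩
  rw [this, Finset.sum_map]
  rfl

theorem card_sdiff_of_mem_stable {G : SimpleGraph V} {k : ℕ} {S I : Finset V}
    (h : I ∈ stable G k S) : (S \ I).card + k = S.card := by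
  obtain ⟨h1, h2, -⟩ := mem_stable.1 h
  rw [← h2, Finset.card_sdiff_add_card_eq_card h1]

theorem stable_empty (G : SimpleGraph V) {k : ℕ} (hk : 1 ≤ k) : stable G k ∅ = ∅ :=
  Finset.eq_empty_of_forall_notMem fun I hI => by
    have := card_sdiff_of_mem_stable hI
    simp only [Finset.empty_sdiff, Finset.card_empty] at this
    omega

open Classical in
/-- The vertices of `S` other than `v` that are not adjacent to `v`. -/
noncomputable def nonNeighbors (G : SimpleGraph V) (S : Finset V) (v : V) : Finset V :=
  S.filter fun u => u ≠ v ∧ ¬ G.Adj v u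

theorem mem_nonNeighbors {G : SimpleGraph V} {S : Finset V} {u v : V} :
    u ∈ nonNeighbors G S v ↔ u ∈ S ∧ u ≠ v ∧ ¬ G.Adj v u := by
  simp [nonNeighbors]

theorem pair_mem_stable {G : SimpleGraph V} {S : Finset V} {u v : V} (hv : v ∈ S)
    (hu : u ∈ nonNeighbors G S v) : {v, u} ∈ stable G 2 S := by
  obtain ⟨h1, h2, h3⟩ := mem_nonNeighbors.1 hu
  refine mem_stable.2 ⟨?_, Finset.card_pair h2.symm, ?_⟩
  · intro x hx
    simp only [Finset.mem_insert, Finset.mem_singleton] at hx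
    rcases hx with rfl | rfl <;> assumption
  · intro x hx y hy hxy
    simp only [Finset.coe_insert, Finset.coe_singleton, Set.mem_insert_iff,
      Set.mem_singleton_iff] at hx hy
    rcases hx with rfl | rfl <;> rcases hy with rfl | rfl
    · exact absurd rfl hxy
    · exact h3
    · exact fun h => h3 h.symm
    · exact absurd rfl hxy

theorem sum_nonNeighbors (G : SimpleGraph V) (S : Finset V) (F : Finset V → ℤ) :
    ∑ v ∈ S, ∑ u ∈ nonNeighbors G S v, F {v, u} = 2 * ∑ e ∈ stable G 2 S, F e := by
  rw [Finset.sum_sigma', Finset.mul_sum]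
  rw [← Finset.sum_fiberwise_of_maps_to (t := stable G 2 S) (g := fun p => {p.1, p.2})]
  · refine Finset.sum_congr rfl fun e he => ?_
    obtain ⟨he1, he2, he3⟩ := mem_stable.1 he
    obtain ⟨a, b, hab, rfl⟩ := Finset.card_eq_two.1 he2
    have hG : ¬ G.Adj a b := he3 (by simp) (by simp) hab
    have : ((S.sigma (nonNeighbors G S)).filter fun p => ({p.1, p.2} : Finset V) = {a, b}) =
        {⟨a, b⟩, ⟨b, a⟩} := by
      ext ⟨x, y⟩
      simp only [Finset.mem_filter, Finset.mem_sigma, mem_nonNeighbors, Finset.mem_insert,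
        Finset.mem_singleton, Sigma.mk.injEq, heq_eq_eq]
      constructor
      · rintro ⟨⟨-, -, hyx, -⟩, h⟩
        have hx : x = a ∨ x = b := by
          have : x ∈ ({a, b} : Finset V) := h ▸ by simp
          simpa using this
        have hy : y = a ∨ y = b := by
          have : y ∈ ({a, b} : Finset V) := h ▸ by simp
          simpa using this
        rcases hx with rfl | rfl <;> rcases hy with rfl | rfl <;> simp_all
      · have ha : a ∈ S := he1 (by simp)
        have hb : b ∈ S := he1 (by simp)
        rintro (⟨rfl, rfl⟩ | ⟨rfl, rfl⟩)
        · exact ⟨⟨ha, hb, hab.symm, hG⟩, rfl⟩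
        · exact ⟨⟨hb, ha, hab, fun h => hG h.symm⟩, Finset.pair_comm _ _⟩
    -- Each stable pair arises from its two orderings, whence the factor `2`.
    rw [this, Finset.sum_pair (by simpa using fun h => (hab h).elim), Finset.pair_comm b a]
    ring
  · rintro ⟨v, u⟩ h
    obtain ⟨h1, h2⟩ := Finset.mem_sigma.1 h
    exact pair_mem_stable h1 h2

/-- If `G` has no stable set with three vertices, this is the number of acyclic orientations
of `G[S]`. -/
noncomputable def acyclicCount (G : SimpleGraph V) (S : Finset V) : ℤ :=
  if S = ∅ then 1 else
    ∑ I ∈ (stable G 1 S).attach, acyclicCount G (S \ I.1) -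
      ∑ I ∈ (stable G 2 S).attach, acyclicCount G (S \ I.1)
termination_by S.card
decreasing_by
  all_goals have := card_sdiff_of_mem_stable I.2; omega

theorem acyclicCount_eq (G : SimpleGraph V) (S : Finset V) :
    acyclicCount G S = (if S = ∅ then 1 else 0) + ∑ I ∈ stable G 1 S, acyclicCount G (S \ I) -
      ∑ I ∈ stable G 2 S, acyclicCount G (S \ I) := by
  rw [acyclicCount]
  split_ifs with h
  · subst h
    have h1 := stable_empty G (k := 1) (by omega)
    have h2 := stable_empty G (k := 2) (by omega)
    simp [h1, h2]
  · rw [zero_add, Finset.sum_attach (stable G 1 S) fun I => acyclicCount G (S \ I),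
      Finset.sum_attach (stable G 2 S) fun I => acyclicCount G (S \ I)]

/-- If `G` has no stable set with three vertices, this is the number of acyclic orientations
of `G[S]` with a single sink. -/
noncomputable def sinkCount (G : SimpleGraph V) (S : Finset V) : ℤ :=
  acyclicCount G S - ∑ I ∈ stable G 2 S, acyclicCount G (S \ I)

/-- This is the identity that makes the linear coefficient of `pairSeries` right. It follows by
applying the recursion of `acyclicCount` to `S` and to each `S \ I`, and exchanging the removal of a
vertex with that of a pair. -/
theorem sinkCount_recursion (G : SimpleGraph V) {S : Finset V} (hS : S.Nonempty) :
    sinkCount G S +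
        ∑ I ∈ stable G 2 S, (sinkCount G (S \ I) + if S \ I = ∅ then 1 else 0) =
      ∑ I ∈ stable G 1 S, sinkCount G (S \ I) := by
  have h1 := acyclicCount_eq G S
  rw [if_neg hS.ne_empty] at h1
  have h2 : ∑ I ∈ stable G 2 S, acyclicCount G (S \ I) =
      ∑ I ∈ stable G 2 S, ((if S \ I = ∅ then 1 else 0) +
        ∑ J ∈ stable G 1 (S \ I), acyclicCount G ((S \ I) \ J) -
        ∑ J ∈ stable G 2 (S \ I), acyclicCount G ((S \ I) \ J)) :=
    Finset.sum_congr rfl fun I _ => acyclicCount_eq G (S \ I)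
  have h3 := stable_sdiff_comm G 2 1 S (acyclicCount G)
  simp only [sinkCount, Finset.sum_add_distrib, Finset.sum_sub_distrib] at h2 ⊢
  linarith

theorem sinkCount_empty (G : SimpleGraph V) : sinkCount G ∅ = 1 := by
  have h := acyclicCount_eq G ∅
  have h2 := stable_empty G (k := 2) (by omega)
  have h1 := stable_empty G (k := 1) (by omega)
  rw [sinkCount, h, h1, h2]
  simp

/-- If `G` has no stable set with three vertices, this is the number of acyclic orientations
of `G[S]` with `v` as the only sink. -/
noncomputable def sinkAtCount (G : SimpleGraph V) (S : Finset V) (v : V) : ℤ :=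
  acyclicCount G (S \ {v}) - ∑ u ∈ nonNeighbors G S v, acyclicCount G (S \ {v, u})

theorem sinkCount_eq_sum (G : SimpleGraph V) {S : Finset V} (hS : S.Nonempty) :
    sinkCount G S = ∑ v ∈ S, sinkAtCount G S v := by
  have h1 := acyclicCount_eq G S
  rw [if_neg hS.ne_empty, sum_stable_one G S fun I => acyclicCount G (S \ I)] at h1
  have h2 := sum_nonNeighbors G S fun e => acyclicCount G (S \ e)
  simp only [sinkCount, sinkAtCount, Finset.sum_sub_distrib]
  linarith

/-- The pairs `{u, w}` on the left are stable, and each occurs once: if both ends were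
non-neighbours of `v`, then `v`, `u`, `w` would be a stable triple. -/
theorem sum_nonNeighbors_le {G : SimpleGraph V} (hG : ∀ S, stable G 3 S = ∅) (S : Finset V)
    (v : V) (F : Finset V → ℤ) (hF : ∀ e ∈ stable G 2 S, 0 ≤ F e) :
    ∑ u ∈ nonNeighbors G S v, ∑ w ∈ nonNeighbors G S u, F {u, w} ≤ ∑ e ∈ stable G 2 S, F e := by
  rw [Finset.sum_sigma', ← Finset.sum_image (g := fun p : Σ _ : V, V => ({p.1, p.2} : Finset V))]
  · refine Finset.sum_le_sum_of_subset_of_nonneg ?_ fun e he _ => hF e he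
    intro e he
    obtain ⟨⟨u, w⟩, hp, rfl⟩ := Finset.mem_image.1 he
    obtain ⟨h1, h2⟩ := Finset.mem_sigma.1 hp
    exact pair_mem_stable (mem_nonNeighbors.1 h1).1 h2
  · rintro ⟨u, w⟩ hp ⟨u', w'⟩ hp' h
    obtain ⟨h1, h2⟩ := Finset.mem_sigma.1 hp
    obtain ⟨h1', h2'⟩ := Finset.mem_sigma.1 hp'
    simp only [mem_nonNeighbors] at h1 h2 h1' h2'
    simp only at h
    have hu' : u' = u ∨ u' = w := by
      have : u' ∈ ({u, w} : Finset V) := h ▸ by simp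
      simpa using this
    have hw' : w' = u ∨ w' = w := by
      have : w' ∈ ({u, w} : Finset V) := h ▸ by simp
      simpa using this
    rcases hu' with rfl | rfl
    · rcases hw' with rfl | rfl
      · exact absurd rfl h2'.2.1
      · rfl
    · exfalso
      have hmem : ({v, u, u'} : Finset V) ∈ stable G 3 {v, u, u'} := by
        refine mem_stable.2 ⟨subset_rfl, ?_, ?_⟩
        · rw [Finset.card_eq_three]
          exact ⟨v, u, u', h1.2.1.symm, h1'.2.1.symm, h2.2.1.symm, rfl⟩
        · intro x hx y hy hxy
          simp only [Finset.coe_insert, Finset.coe_singleton, Set.mem_insert_iff,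
            Set.mem_singleton_iff] at hx hy
          rcases hx with rfl | rfl | rfl <;> rcases hy with rfl | rfl | rfl <;>
            first
            | exact absurd rfl hxy
            | simp [h1.2.2, h1'.2.2, h2.2.2]
            | simp [G.adj_comm, h1.2.2, h1'.2.2, h2.2.2]
            | skip
          · exact fun h => h1.2.2 h.symm
          · exact fun h => h1'.2.2 h.symm
          · exact fun h => h2.2.2 h.symm
      rw [hG] at hmem
      simp at hmem

/-- With `T = S \ {v}`, `acyclicCount G T` is the sum of all `sinkAtCount G T u` and of
`acyclicCount G (T \ e)` over stable pairs `e`. Expanding the subtracted terms of `sinkAtCount G S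
v` in the same way gives only part of these sums, each term at most once, and all the terms are
nonnegative by induction. -/
theorem sinkAtCount_nonneg_aux {G : SimpleGraph V} (hG : ∀ S, stable G 3 S = ∅) (n : ℕ) :
    ∀ S : Finset V, S.card = n → 0 ≤ acyclicCount G S ∧ ∀ v ∈ S, 0 ≤ sinkAtCount G S v := by
  induction n using Nat.strong_induction_on with
  | _ n ih =>
    intro S hS
    have hsub : ∀ {k I}, 1 ≤ k → I ∈ stable G k S → 0 ≤ acyclicCount G (S \ I) := by
      intro k I hk hI
      have := card_sdiff_of_mem_stable hI
      exact (ih _ (by omega) _ rfl).1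
    have hat : ∀ v ∈ S, 0 ≤ sinkAtCount G S v := by
      intro v hv
      have hcard : (S \ {v}).card < n := by
        rw [← hS]
        exact Finset.card_lt_card (Finset.sdiff_ssubset (by simpa using hv) (by simp))
      have hIH := ih _ hcard _ rfl
      set T := S \ {v} with hT
      have hnb : nonNeighbors G S v = nonNeighbors G T v := by
        ext u
        simp only [mem_nonNeighbors, hT, Finset.mem_sdiff, Finset.mem_singleton]
        tauto
      have hpair : ∀ u, S \ {v, u} = T \ {u} := fun u => by
        rw [hT, sdiff_sdiff]
        rfl
      rw [sinkAtCount, hnb]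
      simp only [hpair]
      rcases T.eq_empty_or_nonempty with h | h
      · have : nonNeighbors G T v = ∅ := by simp [nonNeighbors, h]
        rw [this, Finset.sum_empty, sub_zero]
        exact hIH.1
      · have h1 := sinkCount_eq_sum G h
        rw [sinkCount] at h1
        have h2 : ∀ u, acyclicCount G (T \ {u}) = sinkAtCount G T u +
            ∑ w ∈ nonNeighbors G T u, acyclicCount G (T \ {u, w}) := fun u => by
          rw [sinkAtCount]; ring
        have h3 := sum_nonNeighbors_le hG T v (fun e => acyclicCount G (T \ e)) (by
          intro e he
          have := card_sdiff_of_mem_stable he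
          exact (ih _ (by omega) _ rfl).1)
        -- `h3` bounds the contribution of the pairs and `h4` that of the single sinks.
        have h4 : ∑ u ∈ nonNeighbors G T v, sinkAtCount G T u ≤ ∑ u ∈ T, sinkAtCount G T u :=
          Finset.sum_le_sum_of_subset_of_nonneg
            (fun u hu => (mem_nonNeighbors.1 hu).1) fun u hu _ => hIH.2 u hu
        rw [Finset.sum_congr rfl fun u _ => h2 u, Finset.sum_add_distrib]
        linarith
    refine ⟨?_, hat⟩
    rcases S.eq_empty_or_nonempty with rfl | h
    · rw [acyclicCount]; simp
    · have h1 := sinkCount_eq_sum G h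
      have h2 : 0 ≤ ∑ v ∈ S, sinkAtCount G S v := Finset.sum_nonneg hat
      have h3 : 0 ≤ ∑ I ∈ stable G 2 S, acyclicCount G (S \ I) :=
        Finset.sum_nonneg fun I hI => hsub (by omega) hI
      rw [sinkCount] at h1
      linarith

theorem sinkCount_nonneg {G : SimpleGraph V} (hG : ∀ S, stable G 3 S = ∅) (S : Finset V) :
    0 ≤ sinkCount G S := by
  rcases S.eq_empty_or_nonempty with rfl | h
  · rw [sinkCount_empty]; exact zero_le_one
  · rw [sinkCount_eq_sum G h]
    exact Finset.sum_nonneg (sinkAtCount_nonneg_aux hG _ S rfl).2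

/-- For `r = 1` and `G` without stable sets of size three, this is the expansion of the chromatic
symmetric function of `G[S]` in the products `e_i e_{n-i}`. -/
noncomputable def pairSeries (G : SimpleGraph V) (S : Finset V) (r : ℕ) : MvPowerSeries ℕ+ ℤ :=
  sinkCount G S • (shiftedElem r * shiftedElem (r + S.card)) +
    ∑ I ∈ (stable G 2 S).attach, pairSeries G (S \ I.1) (r + 1)
termination_by S.card
decreasing_by
  have := card_sdiff_of_mem_stable I.2; omega

theorem pairSeries_eq (G : SimpleGraph V) (S : Finset V) (r : ℕ) :
    pairSeries G S r = sinkCount G S • (shiftedElem r * shiftedElem (r + S.card)) +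
      ∑ I ∈ stable G 2 S, pairSeries G (S \ I) (r + 1) := by
  rw [pairSeries, Finset.sum_attach (stable G 2 S) fun I => pairSeries G (S \ I) (r + 1)]

theorem pairSeries_isEPositive {G : SimpleGraph V} (hG : ∀ S, stable G 3 S = ∅) (n : ℕ) :
    ∀ (S : Finset V) (r : ℕ), S.card = n → IsEPositive (pairSeries G S (r + 1)) := by
  induction n using Nat.strong_induction_on with
  | _ n ih =>
    intro S r hS
    rw [pairSeries_eq]
    refine IsEPositive.add (IsEPositive.smul ?_ (sinkCount_nonneg hG S))
      (IsEPositive.sum _ fun I hI => ?_)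
    · rw [show r + 1 + S.card = r + S.card + 1 by ring]
      exact isEPositive_elemSymm_mul _ _
    · have := card_sdiff_of_mem_stable hI
      exact ih _ (by omega) _ _ rfl

/-- For `r = 1` the first summand contains `shiftedElem 0 = 0`, leaving exactly the chromatic
recursion. General `r` and this correction term are needed for the induction, which passes from `r`
to `r + 1`. -/
theorem colorCoeff_one_pairSeries (G : SimpleGraph V) (j : ℕ+) (n : ℕ) :
    ∀ (S : Finset V) (r : ℕ), S.card = n →
      colorCoeff j 1 (pairSeries G S r) = colorCoeff j 0
        ((sinkCount G S + if S = ∅ then 1 else 0) •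
            (shiftedElem (r - 1) * shiftedElem (r + S.card)) +
          ∑ I ∈ stable G 1 S, pairSeries G (S \ I) r) := by
  induction n using Nat.strong_induction_on with
  | _ n ih =>
    intro S r hS
    rcases S.eq_empty_or_nonempty with rfl | hne
    · have h1 : stable G 1 (∅ : Finset V) = ∅ :=
        Finset.eq_empty_of_forall_notMem fun I hI => by
          have := card_sdiff_of_mem_stable hI
          simp at this
      have h2 := stable_empty G (k := 2) (by omega)
      rw [pairSeries_eq, h1, h2]
      simp only [sinkCount_empty, Finset.sum_empty, add_zero, one_smul, Finset.card_empty,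
        colorCoeff_pair_one, if_true]
      congr 1
      rw [mul_comm (shiftedElem r), add_smul, one_smul]
    · have hrec := sinkCount_recursion G hne
      have hIH : ∀ I ∈ stable G 2 S, colorCoeff j 1 (pairSeries G (S \ I) (r + 1)) =
          colorCoeff j 0 ((sinkCount G (S \ I) + if S \ I = ∅ then 1 else 0) •
            (shiftedElem r * shiftedElem (r + S.card - 1)) +
          ∑ J ∈ stable G 1 (S \ I), pairSeries G ((S \ I) \ J) (r + 1)) := by
        intro I hI
        have hc := card_sdiff_of_mem_stable hI
        rw [ih _ (by omega) _ (r + 1) rfl, Nat.add_sub_cancel,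
          show r + 1 + (S \ I).card = r + S.card - 1 by omega]
      have hone : ∀ I ∈ stable G 1 S, pairSeries G (S \ I) r =
          sinkCount G (S \ I) • (shiftedElem r * shiftedElem (r + S.card - 1)) +
          ∑ J ∈ stable G 2 (S \ I), pairSeries G ((S \ I) \ J) (r + 1) := by
        intro I hI
        have hc := card_sdiff_of_mem_stable hI
        rw [pairSeries_eq, show r + (S \ I).card = r + S.card - 1 by omega]
      rw [pairSeries_eq, colorCoeff_add, colorCoeff_smul, colorCoeff_pair_one, colorCoeff_sum,
        Finset.sum_congr rfl hIH, ← colorCoeff_sum, ← colorCoeff_smul, ← colorCoeff_add,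
        Finset.sum_congr rfl hone]
      congr 1
      simp only [Finset.sum_add_distrib, ← Finset.sum_smul] at hrec ⊢
      -- The double sums agree after exchanging the order of removal; the coefficients of the
      -- remaining products agree by `sinkCount_recursion`.
      rw [← hrec, stable_sdiff_comm G 2 1 S fun T => pairSeries G T (r + 1), if_neg hne.ne_empty]
      module

/-- Taking `x_j` from both factors lowers both indices by one, which is a shift of `r`. At `r = 0`
the leading term vanishes and the sum over stable pairs remains, as the chromatic recursion demands.
-/
theorem colorCoeff_two_pairSeries (G : SimpleGraph V) (j : ℕ+) (n : ℕ) :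
    ∀ (S : Finset V) (r : ℕ), S.card = n →
      colorCoeff j 2 (pairSeries G S (r + 1)) = colorCoeff j 0 (pairSeries G S r) := by
  induction n using Nat.strong_induction_on with
  | _ n ih =>
    intro S r hS
    rw [pairSeries_eq, pairSeries_eq G S r, colorCoeff_add, colorCoeff_smul, colorCoeff_pair_two,
      colorCoeff_sum, colorCoeff_add, colorCoeff_smul, colorCoeff_sum, Nat.add_sub_cancel,
      show r + 1 + S.card - 1 = r + S.card by omega]
    congr 1
    refine Finset.sum_congr rfl fun I hI => ?_
    have := card_sdiff_of_mem_stable hI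
    exact ih _ (by omega) _ _ rfl

theorem colorCoeff_pairSeries_of_three_le (G : SimpleGraph V) (j : ℕ+) (k : ℕ) (hk : 3 ≤ k)
    (n : ℕ) : ∀ (S : Finset V) (r : ℕ), S.card = n → colorCoeff j k (pairSeries G S r) = 0 := by
  induction n using Nat.strong_induction_on with
  | _ n ih =>
    intro S r hS
    rw [pairSeries_eq, colorCoeff_add, colorCoeff_smul, colorCoeff_pair_of_three_le _ _ _ _ hk,
      colorCoeff_sum, smul_zero, zero_add]
    refine Finset.sum_eq_zero fun I hI => ?_
    have := card_sdiff_of_mem_stable hI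
    exact ih _ (by omega) _ _ rfl

theorem shiftedElem_apply_zero (a : ℕ) : shiftedElem a 0 = if a = 1 then 1 else 0 := by
  match a with
  | 0 => rfl
  | a + 1 =>
    change elemSymm a 0 = _
    simp [elemSymm_apply, eq_comm]

theorem mul_apply_zero (F G : MvPowerSeries ℕ+ ℤ) : (F * G) 0 = F 0 * G 0 := by
  have := map_mul (MvPowerSeries.constantCoeff (σ := ℕ+) (R := ℤ)) F G
  simpa [← MvPowerSeries.coeff_zero_eq_constantCoeff, MvPowerSeries.coeff_apply] using this

theorem pairSeries_apply_zero (G : SimpleGraph V) (n : ℕ) :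
    ∀ (S : Finset V) (r : ℕ), S.card = n →
      pairSeries G S (r + 1) 0 = if S = ∅ ∧ r = 0 then 1 else 0 := by
  induction n using Nat.strong_induction_on with
  | _ n ih =>
    intro S r hS
    have h0 : ∑ I ∈ stable G 2 S, pairSeries G (S \ I) (r + 1 + 1) 0 = 0 :=
      Finset.sum_eq_zero fun I hI => by
        have := card_sdiff_of_mem_stable hI
        rw [ih _ (by omega) _ _ rfl, if_neg (by simp)]
    have h1 : pairSeries G S (r + 1) 0 =
        sinkCount G S * (shiftedElem (r + 1) 0 * shiftedElem (r + 1 + S.card) 0) +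
          ∑ I ∈ stable G 2 S, pairSeries G (S \ I) (r + 1 + 1) 0 := by
      conv_lhs => rw [pairSeries_eq]
      rw [← mul_apply_zero]
      simp only [← MvPowerSeries.coeff_apply, map_sum, map_add, map_zsmul, smul_eq_mul]
    rw [h1, h0, shiftedElem_apply_zero, shiftedElem_apply_zero, add_zero]
    by_cases hr : r = 0
    · by_cases hS : S = ∅
      · subst hS; simp [hr, sinkCount_empty]
      · simp [hr, hS]
    · simp [hr]

theorem pairSeries_isChromaticFamily {G : SimpleGraph V}
    (hG : ∀ S k, 3 ≤ k → stable G k S = ∅) :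
    IsChromaticFamily G fun S => pairSeries G S 1 where
  const S := by simpa using pairSeries_apply_zero G _ S 0 rfl
  colorCoeff S j k hk := by
    rcases (by omega : k = 1 ∨ k = 2 ∨ 3 ≤ k) with rfl | rfl | hk
    · rw [colorCoeff_one_pairSeries G j _ S 1 rfl]
      simp [shiftedElem]
    · rw [colorCoeff_two_pairSeries G j _ S 0 rfl, pairSeries_eq]
      simp [shiftedElem]
    · rw [colorCoeff_pairSeries_of_three_le G j k hk _ S 1 rfl, hG S k hk]
      simp

theorem isEPositive_of_stable_three_eq_empty [Fintype V] {G : SimpleGraph V}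
    (hG : ∀ S k, 3 ≤ k → stable G k S = ∅) : IsEPositive (chromaticSymm G) := by
  rw [← (pairSeries_isChromaticFamily hG).eq_chromaticSymm]
  exact pairSeries_isEPositive (fun S => hG S 3 le_rfl) _ Finset.univ 0 rfl

end PairSeries

/-! ### Graphs without edges -/

section Edgeless

variable {V : Type*} [DecidableEq V]

/-- The binomial coefficient matches the number of `k`-subsets, all of which are stable in an
edgeless graph. The induction on `n` is Pascal's rule. -/
theorem colorCoeff_elemSymm_one_pow (j : ℕ+) (n k : ℕ) :
    colorCoeff j k (elemSymm 1 ^ n) =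
      (n.choose k : ℤ) • colorCoeff j 0 (elemSymm 1 ^ (n - k)) := by
  induction n generalizing k with
  | zero =>
    rcases k with _ | k
    · simp
    · have : (elemSymm 1 ^ 0 : MvPowerSeries ℕ+ ℤ) = shiftedElem 1 := by
        rw [pow_zero, ← elemSymm_zero]; rfl
      rw [this]
      rcases k with _ | k
      · rw [colorCoeff_shiftedElem_one]; simp [shiftedElem]
      · rw [colorCoeff_shiftedElem_of_two_le _ _ _ (by omega)]; simp
  | succ n ih =>
    rcases k with _ | k
    · simp
    · have h1 : elemSymm 1 = shiftedElem 2 := rfl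
      have h2 : shiftedElem (2 - 1) = 1 := elemSymm_zero
      rw [pow_succ, h1, colorCoeff_mul_shiftedElem, ← h1, ih, ih, h2, Nat.succ_sub_succ,
        smul_mul_assoc, ← colorCoeff_zero_mul, ← pow_succ, smul_mul_assoc, ← colorCoeff_zero_mul,
        mul_one, Nat.choose_succ_succ]
      rcases Nat.lt_or_ge k n with h | h
      · rw [show n - (k + 1) + 1 = n - k by omega, ← add_smul]
        push_cast
        rw [add_comm]
      · rw [Nat.choose_eq_zero_of_lt (by omega : n < k + 1)]
        simp

theorem isEPositive_of_edgeless [Fintype V] {G : SimpleGraph V} (hG : ∀ u v, ¬ G.Adj u v) :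
    IsEPositive (chromaticSymm G) := by
  have hst : ∀ S k, stable G k S = S.powersetCard k := fun S k => by
    ext I
    simp [mem_stable, Finset.mem_powersetCard, SimpleGraph.IsIndepSet, Set.Pairwise, hG]
  have : IsChromaticFamily G fun S => elemSymm 1 ^ S.card := by
    refine ⟨fun S => ?_, fun S j k _ => ?_⟩
    · have h1 : ∀ n : ℕ, (elemSymm 1 ^ n) 0 = if n = 0 then (1 : ℤ) else 0 := by
        intro n
        rcases n with _ | n
        · rw [pow_zero, ← elemSymm_zero, elemSymm_apply]; simp
        · rw [pow_succ, mul_apply_zero, elemSymm_apply]; simp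
      simp [h1]
    · have : ∀ I ∈ stable G k S, elemSymm 1 ^ (S \ I).card = elemSymm 1 ^ (S.card - k) := by
        intro I hI
        have := card_sdiff_of_mem_stable hI
        rw [show (S \ I).card = S.card - k by omega]
      rw [Finset.sum_congr rfl this, colorCoeff_elemSymm_one_pow, hst, Finset.sum_const,
        Finset.card_powersetCard, ← colorCoeff_smul]
      simp
  rw [← this.eq_chromaticSymm]
  simpa using isEPositive_prod_elemSymm (Multiset.replicate (Finset.univ : Finset V).card 1)

end Edgeless

/-! ### Products of three elementary symmetric functions -/

/-- The product `e_{a-1} e_{b-1} e_{c-1}`, which is zero if one of the indices is zero. -/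
noncomputable def tripleElem (a b c : ℕ) : MvPowerSeries ℕ+ ℤ :=
  shiftedElem a * shiftedElem b * shiftedElem c

/-- The coefficient of `tripleElem a b c` at a monomial with the given list of exponents. -/
def tripleCount : List ℕ → ℕ → ℕ → ℕ → ℕ
  | [], a, b, c => if a = 1 ∧ b = 1 ∧ c = 1 then 1 else 0
  | 0 :: L, a, b, c => tripleCount L a b c
  | 1 :: L, a, b, c => tripleCount L (a - 1) b c + tripleCount L a (b - 1) c +
      tripleCount L a b (c - 1)
  | 2 :: L, a, b, c => tripleCount L (a - 1) (b - 1) c + tripleCount L (a - 1) b (c - 1) +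
      tripleCount L a (b - 1) (c - 1)
  | 3 :: L, a, b, c => tripleCount L (a - 1) (b - 1) (c - 1)
  | (_ + 4) :: _, _, _, _ => 0

theorem colorCoeff_one_tripleElem (j : ℕ+) (a b c : ℕ) :
    colorCoeff j 1 (tripleElem a b c) = colorCoeff j 0
      (tripleElem (a - 1) b c + tripleElem a (b - 1) c + tripleElem a b (c - 1)) := by
  rw [tripleElem, colorCoeff_mul_shiftedElem j 0, colorCoeff_pair_one]
  simp only [tripleElem, colorCoeff_add, colorCoeff_zero_mul]
  ring

theorem colorCoeff_two_tripleElem (j : ℕ+) (a b c : ℕ) :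
    colorCoeff j 2 (tripleElem a b c) = colorCoeff j 0
      (tripleElem (a - 1) (b - 1) c + tripleElem (a - 1) b (c - 1) +
        tripleElem a (b - 1) (c - 1)) := by
  rw [tripleElem, colorCoeff_mul_shiftedElem j 1, colorCoeff_pair_one, colorCoeff_pair_two]
  simp only [tripleElem, colorCoeff_add, colorCoeff_zero_mul]
  ring

theorem colorCoeff_three_tripleElem (j : ℕ+) (a b c : ℕ) :
    colorCoeff j 3 (tripleElem a b c) =
      colorCoeff j 0 (tripleElem (a - 1) (b - 1) (c - 1)) := by
  rw [tripleElem, colorCoeff_mul_shiftedElem j 2, colorCoeff_pair_two,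
    colorCoeff_pair_of_three_le _ _ _ _ le_rfl]
  simp only [tripleElem, colorCoeff_zero_mul]
  ring

theorem colorCoeff_tripleElem_of_four_le (j : ℕ+) (a b c k : ℕ) :
    colorCoeff j (k + 4) (tripleElem a b c) = 0 := by
  rw [tripleElem, colorCoeff_mul_shiftedElem j (k + 3),
    colorCoeff_pair_of_three_le _ _ _ (k + 3 + 1) (by omega),
    colorCoeff_pair_of_three_le _ _ _ (k + 3) (by omega)]
  simp

theorem tripleElem_apply (js : List ℕ+) (hjs : js.Nodup) (m : ℕ+ →₀ ℕ)
    (hm : ∀ j, j ∈ js ↔ m j ≠ 0) (a b c : ℕ) :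
    tripleElem a b c m = tripleCount (js.map m) a b c := by
  induction js generalizing m a b c with
  | nil =>
    have hm0 : m = 0 := Finsupp.ext fun j => by
      by_contra h
      simpa using (hm j).2 h
    subst hm0
    rw [tripleElem, mul_apply_zero, mul_apply_zero]
    simp only [shiftedElem_apply_zero, List.map_nil, tripleCount]
    split_ifs <;> simp_all
  | cons j js ih =>
    rw [List.nodup_cons] at hjs
    have hm' : ∀ k, k ∈ js ↔ m.erase j k ≠ 0 := fun k => by
      by_cases hkj : k = j
      · subst hkj; simpa using hjs.1
      · rw [Finsupp.erase_ne hkj, ← hm k]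
        simp [hkj]
    have hmap : js.map (m.erase j) = js.map m := List.map_congr_left fun k hk =>
      Finsupp.erase_ne (by rintro rfl; exact hjs.1 hk)
    have hIH := ih hjs.2 _ hm'
    rw [hmap] at hIH
    have hj : m j ≠ 0 := (hm j).1 (by simp)
    have hadd : ∀ (F G : MvPowerSeries ℕ+ ℤ) n, (F + G) n = F n + G n := fun _ _ _ => rfl
    rw [← colorCoeff_apply_erase j (tripleElem a b c) m, List.map_cons]
    generalize m j = k at hj ⊢
    match k with
    | 0 => exact absurd rfl hj
    | 1 =>
      rw [colorCoeff_one_tripleElem, colorCoeff_zero_apply_erase]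
      simp only [hadd, hIH, tripleCount]
      push_cast
      rfl
    | 2 =>
      rw [colorCoeff_two_tripleElem, colorCoeff_zero_apply_erase]
      simp only [hadd, hIH, tripleCount]
      push_cast
      rfl
    | 3 =>
      rw [colorCoeff_three_tripleElem, colorCoeff_zero_apply_erase]
      simp only [hIH, tripleCount]
    | k + 4 =>
      rw [colorCoeff_tripleElem_of_four_le]
      simp only [tripleCount]
      rfl

theorem tripleElem_isEPositive (a b c : ℕ) : IsEPositive (tripleElem (a + 1) (b + 1) (c + 1)) :=
  isEPositive_elemSymm_mul_mul a b c

theorem tripleCount_zero (L : List ℕ) (a b c : ℕ) :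
    tripleCount L 0 b c = 0 ∧ tripleCount L a 0 c = 0 ∧ tripleCount L a b 0 = 0 := by
  induction L generalizing a b c with
  | nil => simp [tripleCount]
  | cons k L ih =>
    match k with
    | 0 | 1 | 2 | 3 =>
      simp [tripleCount, fun b c => (ih 0 b c).1, fun a c => (ih a 0 c).2.1,
        fun a b => (ih a b 0).2.2]
    | k + 4 => simp [tripleCount]

/-- The product is homogeneous; the `3` compensates for the shift of the three indices. -/
theorem tripleCount_eq_zero {L : List ℕ} {a b c : ℕ} (h : a + b + c ≠ L.sum + 3) :
    tripleCount L a b c = 0 := by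
  have h1 := fun (L : List ℕ) b c => (tripleCount_zero L 0 b c).1
  have h2 := fun (L : List ℕ) a c => (tripleCount_zero L a 0 c).2.1
  have h3 := fun (L : List ℕ) a b => (tripleCount_zero L a b 0).2.2
  induction L generalizing a b c with
  | nil =>
    simp only [tripleCount, List.sum_nil] at h ⊢
    rw [if_neg (by omega)]
  | cons k L ih =>
    rw [List.sum_cons] at h
    rcases a with _ | a
    · exact h1 _ _ _
    rcases b with _ | b
    · exact h2 _ _ _
    rcases c with _ | c
    · exact h3 _ _ _
    match k with
    | 0 =>
      simp only [tripleCount]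
      exact ih (by omega)
    | 1 =>
      simp only [tripleCount, Nat.add_sub_cancel]
      rw [ih (by omega), ih (by omega), ih (by omega)]
    | 2 =>
      simp only [tripleCount, Nat.add_sub_cancel]
      rw [ih (by omega), ih (by omega), ih (by omega)]
    | 3 =>
      simp only [tripleCount, Nat.add_sub_cancel]
      exact ih (by omega)
    | k + 4 => rfl

/-- Squarefree monomials have multinomial coefficients. The product form makes the division in
`pairTripleCount` exact. -/
theorem tripleCount_replicate_one_mul (z a b c : ℕ) (h : a + b + c = z) :
    tripleCount (List.replicate z 1) (a + 1) (b + 1) (c + 1) *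
      (a.factorial * b.factorial * c.factorial) = z.factorial := by
  induction z generalizing a b c with
  | zero =>
    obtain ⟨⟨rfl, rfl⟩, rfl⟩ : (a = 0 ∧ b = 0) ∧ c = 0 := by omega
    simp [tripleCount]
  | succ z ih =>
    have ha : tripleCount (List.replicate z 1) a (b + 1) (c + 1) *
        (a.factorial * b.factorial * c.factorial) = a * z.factorial := by
      rcases a with _ | a
      · rw [(tripleCount_zero _ 0 _ _).1]; simp
      · rw [← ih a b c (by omega), Nat.factorial_succ]; ring
    have hb : tripleCount (List.replicate z 1) (a + 1) b (c + 1) *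
        (a.factorial * b.factorial * c.factorial) = b * z.factorial := by
      rcases b with _ | b
      · rw [(tripleCount_zero _ _ 0 _).2.1]; simp
      · rw [← ih a b c (by omega), Nat.factorial_succ]; ring
    have hc : tripleCount (List.replicate z 1) (a + 1) (b + 1) c *
        (a.factorial * b.factorial * c.factorial) = c * z.factorial := by
      rcases c with _ | c
      · rw [(tripleCount_zero _ _ _ 0).2.2]; simp
      · rw [← ih a b c (by omega), Nat.factorial_succ]; ring
    simp only [List.replicate_succ, tripleCount, Nat.add_sub_cancel, add_mul]
    rw [ha, hb, hc, Nat.factorial_succ, ← add_mul, ← add_mul, h]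

/-! ### Evaluation of the counts -/

/-- `forced n f = f n`; the match makes the kernel evaluate `n` before it is used. -/
def forced {α : Type*} (n : ℕ) (f : ℕ → α) : α :=
  match n with
  | 0 => f 0
  | k + 1 => f (k + 1)

@[simp]
theorem forced_eq {α : Type*} (n : ℕ) (f : ℕ → α) : forced n f = f n := by
  cases n <;> rfl

/-- An efficient form of `tripleCount` for `y` twos followed by `z` ones. -/
def pairTripleCount : ℕ → ℕ → ℕ → ℕ → ℕ → ℕ
  | 0, z, a, b, c => bif (Nat.beq a 0 || Nat.beq b 0 || Nat.beq c 0) then 0 else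
      bif Nat.beq (a + b + c) (z + 3) then
        z.factorial / ((a - 1).factorial * (b - 1).factorial * (c - 1).factorial) else 0
  | y + 1, z, a, b, c => forced (a - 1) fun a' => forced (b - 1) fun b' => forced (c - 1) fun c' =>
      pairTripleCount y z a' b' c + pairTripleCount y z a' b c' + pairTripleCount y z a b' c'

theorem pairTripleCount_eq (y z a b c : ℕ) :
    pairTripleCount y z a b c =
      tripleCount (List.replicate y 2 ++ List.replicate z 1) a b c := by
  induction y generalizing a b c with
  | zero =>
    rw [List.replicate_zero, List.nil_append]
    rcases a with _ | a
    · rw [(tripleCount_zero _ 0 _ _).1]; rfl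
    rcases b with _ | b
    · rw [(tripleCount_zero _ _ 0 _).2.1]; simp [pairTripleCount]
    rcases c with _ | c
    · rw [(tripleCount_zero _ _ _ 0).2.2]; simp [pairTripleCount]
    by_cases h : a + b + c = z
    · have h0 : 0 < a.factorial * b.factorial * c.factorial := by positivity
      have h2 : (a + 1 + (b + 1) + (c + 1)) = z + 3 := by omega
      simp only [pairTripleCount, Nat.add_sub_cancel, h2, Nat.beq_refl, cond_true]
      rw [← tripleCount_replicate_one_mul z a b c h, Nat.mul_div_cancel _ h0]
      rfl
    · rw [tripleCount_eq_zero (by simp; omega)]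
      have : Nat.beq (a + 1 + (b + 1) + (c + 1)) (z + 3) = false := by
        rw [← Bool.not_eq_true, Nat.beq_eq]
        omega
      simp [pairTripleCount, this]
  | succ y ih =>
    simp only [pairTripleCount, forced_eq, ih, List.replicate_succ, List.cons_append, tripleCount]

/-- An exponent `3` takes its variable from all three factors, so `x` of them lower every index by
`x`. -/
theorem tripleCount_replicate (x y z a b c : ℕ) :
    tripleCount (List.replicate x 3 ++ (List.replicate y 2 ++ List.replicate z 1)) a b c =
      pairTripleCount y z (a - x) (b - x) (c - x) := by
  induction x generalizing a b c with
  | zero => simp [pairTripleCount_eq]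
  | succ x ih =>
    simp only [List.replicate_succ, List.cons_append, tripleCount]
    rw [ih]
    congr 1 <;> omega

theorem count_replicate_one {V : Type*} [DecidableEq V] (G : SimpleGraph V) (z : ℕ) (S : Finset V)
    (hS : S.card = z) : count G (List.replicate z 1) S = z.factorial := by
  induction z generalizing S with
  | zero => simp [count, Finset.card_eq_zero.1 hS]
  | succ z ih =>
    rw [List.replicate_succ, count, sum_stable_one]
    rw [Finset.sum_congr rfl fun v hv => ih (S \ {v}) (by
      rw [Finset.card_sdiff_of_subset (by simpa using hv), hS]; simp)]
    rw [Finset.sum_const, hS, Nat.factorial_succ, smul_eq_mul]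

theorem count_eq_zero_of_sum_ne {V : Type*} [DecidableEq V] (G : SimpleGraph V) {L : List ℕ}
    {S : Finset V} (hS : S.card ≠ L.sum) : count G L S = 0 := by
  induction L generalizing S with
  | nil =>
    rw [count, if_neg]
    rintro rfl
    simp at hS
  | cons k L ih =>
    rw [count]
    refine Finset.sum_eq_zero fun I hI => ih ?_
    have := card_sdiff_of_mem_stable hI
    rw [List.sum_cons] at hS
    omega

theorem count_map {V W : Type*} [DecidableEq V] [DecidableEq W] {G : SimpleGraph V}
    {G' : SimpleGraph W} (f : G ↪g G') (L : List ℕ) (S : Finset V) :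
    count G' L (S.map f.toEmbedding) = count G L S := by
  induction L generalizing S with
  | nil => simp [count]
  | cons k L ih =>
    have hst : stable G' k (S.map f.toEmbedding) =
        (stable G k S).map ⟨fun I => I.map f.toEmbedding, Finset.map_injective _⟩ := by
      ext J
      simp only [Finset.mem_map, mem_stable, Function.Embedding.coeFn_mk]
      constructor
      · rintro ⟨h1, h2, h3⟩
        obtain ⟨I, hI, rfl⟩ := Finset.subset_map_iff.1 h1
        refine ⟨I, ⟨hI, by simpa using h2, fun u hu v hv huv h => ?_⟩, rfl⟩
        exact h3 (x := f u) (by simpa using hu) (y := f v) (by simpa using hv)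
          (f.injective.ne huv) (f.map_adj_iff.2 h)
      · rintro ⟨I, ⟨h1, h2, h3⟩, rfl⟩
        refine ⟨Finset.map_subset_map.2 h1, by simpa using h2, ?_⟩
        intro u hu v hv huv h
        simp only [Finset.coe_map, Set.mem_image] at hu hv
        obtain ⟨u, hu, rfl⟩ := hu
        obtain ⟨v, hv, rfl⟩ := hv
        exact h3 hu hv (fun e => huv (by rw [e])) (f.map_adj_iff.1 h)
    rw [count, count, hst, Finset.sum_map]
    refine Finset.sum_congr rfl fun I _ => ?_
    rw [← ih (S \ I)]
    congr 1
    ext w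
    simp only [Function.Embedding.coeFn_mk, Finset.mem_sdiff, Finset.mem_map]
    constructor
    · rintro ⟨⟨v, hv, rfl⟩, h⟩
      exact ⟨v, ⟨hv, fun hI => h ⟨v, hI, rfl⟩⟩, rfl⟩
    · rintro ⟨v, ⟨hv, hI⟩, rfl⟩
      exact ⟨⟨v, hv, rfl⟩, fun ⟨v', h', e⟩ => hI (f.injective e ▸ h')⟩

/-! ### The induced subgraphs of two graphs on nine vertices -/

/-- Non-adjacency in `gridGraph z`: the complement consists of three triangles (the rows), with a
triangle on the first column and a perfect matching between the remaining vertices of any two rows.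
The matching between the last two rows is twisted if `z = true`. -/
def gridRel (z : Bool) (u v : Fin 3 × Fin 3) : Bool :=
  if u.1 = v.1 then u.2 ≠ v.2
  else if u.2 = 0 ∨ v.2 = 0 ∨ u.1 = 0 ∨ v.1 = 0 then u.2 = v.2
  else xor z (u.2 = v.2)

theorem gridRel_comm (z : Bool) (u v : Fin 3 × Fin 3) : gridRel z u v = gridRel z v u := by
  revert z u v
  decide +kernel

/-- The graph whose complement is described by `gridRel`. -/
def gridGraph (z : Bool) : SimpleGraph (Fin 3 × Fin 3) where
  Adj u v := u ≠ v ∧ gridRel z u v = false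
  symm := ⟨fun u v h => ⟨h.1.symm, gridRel_comm z u v ▸ h.2⟩⟩
  loopless := ⟨fun _ h => h.1 rfl⟩

/-- The set of vertices encoded by the bits of `s`. -/
def gridVerts (s : ℕ) : Finset (Fin 3 × Fin 3) :=
  Finset.univ.filter fun u => s.testBit (3 * u.1 + u.2)

theorem mem_gridVerts {s : ℕ} {u : Fin 3 × Fin 3} :
    u ∈ gridVerts s ↔ s.testBit (3 * u.1 + u.2) = true := by
  simp [gridVerts]

theorem gridVerts_injOn {s t : ℕ} (hs : s < 512) (ht : t < 512)
    (h : gridVerts s = gridVerts t) : s = t := by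
  refine Nat.eq_of_testBit_eq fun i => ?_
  by_cases hi : i < 9
  · have key : ∀ u : Fin 3 × Fin 3, s.testBit (3 * u.1 + u.2) = t.testBit (3 * u.1 + u.2) :=
      fun u => by
        rw [Bool.eq_iff_iff, ← mem_gridVerts, ← mem_gridVerts, h]
    have := key (⟨i / 3, by omega⟩, ⟨i % 3, by omega⟩)
    simpa only [Nat.div_add_mod] using this
  · have h9 : 2 ^ 9 ≤ 2 ^ i := Nat.pow_le_pow_right (by omega) (by omega)
    rw [Nat.testBit_lt_two_pow (by omega), Nat.testBit_lt_two_pow (by omega)]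

theorem exists_gridVerts (S : Finset (Fin 3 × Fin 3)) : ∃ s < 512, gridVerts s = S := by
  refine ⟨Nat.ofBits fun i : Fin 9 =>
    decide (((⟨i / 3, by omega⟩, ⟨i % 3, by omega⟩) : Fin 3 × Fin 3) ∈ S),
    Nat.ofBits_lt_two_pow _, ?_⟩
  ext ⟨p, q⟩
  rw [mem_gridVerts, Nat.testBit_ofBits_lt _ _ (by simp only; omega)]
  have h1 : (3 * (p : ℕ) + q) / 3 = p := by omega
  have h2 : (3 * (p : ℕ) + q) % 3 = q := by omega
  simp [h1, h2]

theorem land_eq_iff {s t : ℕ} (ht : t < 512) :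
    Nat.land t s = t ↔ gridVerts t ⊆ gridVerts s := by
  change t &&& s = t ↔ _
  constructor
  · intro h u hu
    rw [mem_gridVerts] at hu ⊢
    rw [← h, Nat.testBit_and, Bool.and_eq_true] at hu
    exact hu.2
  · intro h
    refine gridVerts_injOn (lt_of_le_of_lt Nat.and_le_left ht) ht ?_
    ext u
    have := @h u
    simp only [mem_gridVerts, Nat.testBit_and, Bool.and_eq_true] at this ⊢
    tauto

theorem gridVerts_xor {s t : ℕ} (h : gridVerts t ⊆ gridVerts s) :
    gridVerts (Nat.xor s t) = gridVerts s \ gridVerts t := by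
  change gridVerts (s ^^^ t) = _
  ext u
  have := @h u
  simp only [mem_gridVerts, Nat.testBit_xor, Finset.mem_sdiff] at this ⊢
  revert this
  cases s.testBit (3 * u.1 + u.2) <;> cases t.testBit (3 * u.1 + u.2) <;> simp

/-- The two-element stable sets of `gridGraph z`. -/
def gridEdges (z : Bool) : List ℕ :=
  [3, 5, 6, 24, 40, 48, 192, 320, 384, 9, 65, 72, 18, 36, 130, 260] ++
    (bif z then [272, 160] else [144, 288])

/-- The three-element stable sets of `gridGraph z`. -/
def gridTriangles (z : Bool) : List ℕ :=
  [7, 56, 448, 73] ++ (bif z then [] else [146, 292])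

/-- `F` lists the stable sets of `gridGraph z` of size `k`. -/
def ListsStable (z : Bool) (k : ℕ) (F : List ℕ) : Prop :=
  F.Nodup ∧ (∀ t ∈ F, t < 512) ∧ ∀ s < 512, ((gridVerts s).card = k ∧
    ∀ u ∈ gridVerts s, ∀ v ∈ gridVerts s, u ≠ v → gridRel z u v = true) ↔ s ∈ F

instance (z : Bool) (k : ℕ) (F : List ℕ) : Decidable (ListsStable z k F) := by
  have (s : ℕ) : Decidable ((gridVerts s).card = k ∧
      ∀ u ∈ gridVerts s, ∀ v ∈ gridVerts s, u ≠ v → gridRel z u v = true) := inferInstance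
  unfold ListsStable
  infer_instance

theorem listsStable_gridEdges (z : Bool) : ListsStable z 2 (gridEdges z) := by
  revert z
  decide +kernel

theorem listsStable_gridTriangles (z : Bool) : ListsStable z 3 (gridTriangles z) := by
  revert z
  decide +kernel

theorem listsStable_four (z : Bool) : ListsStable z 4 [] := by
  revert z
  decide +kernel

theorem ListsStable.mem_iff {z : Bool} {k : ℕ} {F : List ℕ} (h : ListsStable z k F)
    {I S : Finset (Fin 3 × Fin 3)} :
    I ∈ stable (gridGraph z) k S ↔ ∃ t ∈ F, gridVerts t = I ∧ I ⊆ S := by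
  obtain ⟨i, hi, rfl⟩ := exists_gridVerts I
  have key : (gridGraph z).IsIndepSet (gridVerts i : Set (Fin 3 × Fin 3)) ↔
      ∀ u ∈ gridVerts i, ∀ v ∈ gridVerts i, u ≠ v → gridRel z u v = true := by
    refine ⟨fun h u hu v hv huv => ?_, fun h u hu v hv huv h' => ?_⟩
    · have := h hu hv huv
      by_contra hrel
      exact this ⟨huv, by simpa using hrel⟩
    · have := h u hu v hv huv
      rw [h'.2] at this
      simp at this
  rw [mem_stable, key, h.2.2 i hi]
  constructor
  · rintro ⟨h1, h2⟩
    exact ⟨i, h2, rfl, h1⟩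
  · rintro ⟨t, ht, e, h1⟩
    exact ⟨h1, gridVerts_injOn (h.2.1 t ht) hi e ▸ ht⟩

/-- Masks below `512` correspond bijectively to vertex sets, so containment is tested by `land` and
removal of a contained set is done by `xor`. -/
theorem ListsStable.sum_eq {z : Bool} {k : ℕ} {F : List ℕ} (h : ListsStable z k F) (s : ℕ)
    (f : Finset (Fin 3 × Fin 3) → ℕ) :
    ∑ I ∈ stable (gridGraph z) k (gridVerts s), f (gridVerts s \ I) =
      F.foldr (fun t r => (bif Nat.beq (Nat.land t s) t then
        f (gridVerts (Nat.xor s t)) else 0) + r) 0 := by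
  have hst : stable (gridGraph z) k (gridVerts s) =
      (F.toFinset.filter fun t => gridVerts t ⊆ gridVerts s).image gridVerts := by
    ext I
    simp only [h.mem_iff, Finset.mem_image, Finset.mem_filter, List.mem_toFinset]
    constructor
    · rintro ⟨t, ht, rfl, hS⟩
      exact ⟨t, ⟨ht, hS⟩, rfl⟩
    · rintro ⟨t, ⟨ht, hS⟩, rfl⟩
      exact ⟨t, ht, rfl, hS⟩
  have hfold : ∀ l : List ℕ, (∀ t ∈ l, t < 512) →
      l.foldr (fun t r => (bif Nat.beq (Nat.land t s) t then
        f (gridVerts (Nat.xor s t)) else 0) + r) 0 =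
      (l.map fun t => if gridVerts t ⊆ gridVerts s then f (gridVerts s \ gridVerts t) else 0).sum := by
    intro l hl
    induction l with
    | nil => rfl
    | cons t l ih =>
      rw [List.foldr_cons, List.map_cons, List.sum_cons,
        ih fun x hx => hl x (List.mem_cons_of_mem _ hx)]
      congr 1
      have h1 := land_eq_iff (s := s) (hl t (by simp))
      by_cases hsub : gridVerts t ⊆ gridVerts s
      · rw [if_pos hsub, h1.2 hsub, Nat.beq_refl, gridVerts_xor hsub, cond_true]
      · have : Nat.beq (Nat.land t s) t = false := by
          rw [← Bool.not_eq_true, Nat.beq_eq, h1]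
          exact hsub
        rw [if_neg hsub, this, cond_false]
  rw [hfold F h.2.1, hst, Finset.sum_image, Finset.sum_filter, List.sum_toFinset _ h.1]
  intro s' hs' t ht e
  simp only [Finset.coe_filter, List.mem_toFinset, Set.mem_ofPred_eq] at hs' ht
  exact gridVerts_injOn (h.2.1 _ hs'.1) (h.2.1 _ ht.1) e

/-- An efficient form of `count` for `gridGraph z`: a stable set is chosen successively from each
of the given lists, and the remaining `n` vertices get distinct colours. -/
def maskCount : List (List ℕ) → ℕ → ℕ → ℕ
  | [], n, _ => n.factorial
  | F :: Fs, n, s => F.foldr (fun t r => (bif Nat.beq (Nat.land t s) t then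
      forced (Nat.xor s t) (maskCount Fs n) else 0) + r) 0

theorem maskCount_eq (z : Bool) (ks : List ℕ) (Fs : List (List ℕ))
    (h : List.Forall₂ (ListsStable z) ks Fs) (n s : ℕ) (hs : (gridVerts s).card = ks.sum + n) :
    maskCount Fs n s = count (gridGraph z) (ks ++ List.replicate n 1) (gridVerts s) := by
  induction h generalizing s with
  | nil =>
    rw [List.nil_append, count_replicate_one _ _ _ (by simpa using hs)]
    rfl
  | @cons k F ks Fs hF _ ih =>
    rw [List.sum_cons] at hs
    rw [List.cons_append, count]
    -- `ListsStable.sum_eq` needs a summand defined on all sets, while the induction hypothesis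
    -- holds only for sets of the right size; the `if` carries that size through the rewriting.
    have : ∀ I ∈ stable (gridGraph z) k (gridVerts s),
        count (gridGraph z) (ks ++ List.replicate n 1) (gridVerts s \ I) =
        if (gridVerts s \ I).card = ks.sum + n then
          count (gridGraph z) (ks ++ List.replicate n 1) (gridVerts s \ I) else 0 := by
      intro I hI
      have := card_sdiff_of_mem_stable hI
      rw [if_pos (by omega)]
    rw [Finset.sum_congr rfl this, hF.sum_eq s fun S => if S.card = ks.sum + n then
          count (gridGraph z) (ks ++ List.replicate n 1) S else 0]
    simp only [maskCount, forced_eq]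
    have hcongr : ∀ l : List ℕ, (∀ t ∈ l, t ∈ F) →
        l.foldr (fun t r => (bif Nat.beq (Nat.land t s) t then
          maskCount Fs n (Nat.xor s t) else 0) + r) 0 =
        l.foldr (fun t r => (bif Nat.beq (Nat.land t s) t then
          (if (gridVerts (Nat.xor s t)).card = ks.sum + n then
            count (gridGraph z) (ks ++ List.replicate n 1) (gridVerts (Nat.xor s t)) else 0)
            else 0) + r) 0 := by
      intro l hl
      induction l with
      | nil => rfl
      | cons t l ihl =>
        rw [List.foldr_cons, List.foldr_cons, ihl fun x hx => hl x (List.mem_cons_of_mem _ hx)]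
        congr 1
        have htF := hl t (by simp)
        by_cases hb : Nat.beq (Nat.land t s) t = true
        · have hsub := (land_eq_iff (hF.2.1 t htF)).1 (Nat.eq_of_beq_eq_true hb)
          have hmem : gridVerts t ∈ stable (gridGraph z) k (gridVerts s) :=
            hF.mem_iff.2 ⟨t, htF, rfl, hsub⟩
          have hc := card_sdiff_of_mem_stable hmem
          rw [← gridVerts_xor hsub] at hc
          rw [hb, cond_true, cond_true, if_pos (by omega), ih _ (by omega)]
        · rw [Bool.not_eq_true] at hb
          rw [hb, cond_false, cond_false]
    exact hcongr F fun _ h => h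

/-! ### Computing and verifying the expansions -/

/-- A term `c • e_{x+y+z} e_{x+y} e_x` of an expansion. -/
structure Term where
  /-- the smallest index -/
  x : ℕ
  /-- the difference of the other two indices and the smallest index -/
  y : ℕ
  /-- the difference of the two larger indices -/
  z : ℕ
  /-- the coefficient -/
  c : ℕ

/-- The coefficient of an expansion at a monomial with exponents `3^x 2^y 1^z`. -/
def expansionCount (x y z : ℕ) (l : List Term) : ℕ :=
  l.foldr (fun p r => p.c * pairTripleCount y z (p.x + p.y + p.z + 1 - x) (p.x + p.y + 1 - x)
    (p.x + 1 - x) + r) 0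

/-- The triples `(x, y, z)` with `3 x + 2 y + z = n`, for `n ≤ 9`. -/
def contentTypes (n : ℕ) : List (ℕ × ℕ × ℕ) :=
  -- Total degree at most `9` gives `x < 4` and `y < 5`. The reversal lists the lexicographically
  -- largest contents first, the order in which the system is triangular: `e_{x+y+z} e_{x+y} e_x`
  -- has leading content `3^x 2^y 1^z`, with coefficient `1`.
  ((List.range 4).reverse.product (List.range 5).reverse).filterMap fun p =>
    if 3 * p.1 + 2 * p.2 ≤ n then some (p.1, p.2, n - 3 * p.1 - 2 * p.2) else none

/-- Check that an expansion has the same coefficients as the chromatic symmetric function. -/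
def verifyExpansion (E T : List ℕ) (n s : ℕ) (l : List Term) : Bool :=
  l.all (fun p => Nat.beq (3 * p.x + 2 * p.y + p.z) n) &&
  (contentTypes n).all fun p => Nat.beq
    (maskCount (List.replicate p.1 T ++ List.replicate p.2.1 E) p.2.2 s)
    (expansionCount p.1 p.2.1 p.2.2 l)

/-- Find the expansion by solving a triangular system of equations, and verify it. -/
def findExpansion (E T : List ℕ) (n s : ℕ) : List (ℕ × ℕ × ℕ) → List Term → Bool
  | [], l => verifyExpansion E T n s l
  -- The subtraction is truncated, but nothing rests on this search: the final verification would
  -- reject an expansion spoilt by a negative difference.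
  | p :: ps, l => forced (maskCount (List.replicate p.1 T ++ List.replicate p.2.1 E) p.2.2 s -
      expansionCount p.1 p.2.1 p.2.2 l) fun c =>
        findExpansion E T n s ps (⟨p.1, p.2.1, p.2.2, c⟩ :: l)

theorem exists_verifyExpansion {E T : List ℕ} {n s : ℕ} {ps : List (ℕ × ℕ × ℕ)} {l : List Term}
    (h : findExpansion E T n s ps l = true) : ∃ l, verifyExpansion E T n s l = true := by
  induction ps generalizing l with
  | nil => exact ⟨l, h⟩
  | cons p ps ih =>
    rw [findExpansion, forced_eq] at h
    exact ih h

/-- Check all vertex sets containing the first column. -/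
def gridCheck (z : Bool) : Bool :=
  (List.range 512).all fun s => bif Nat.beq (Nat.land 73 s) 73 then
    forced (gridVerts s).card fun n =>
      findExpansion (gridEdges z) (gridTriangles z) n s (contentTypes n) [] else true

/-- The finite computation, run in the kernel: `64` vertex sets contain the first column, for each
of the two graphs. Coefficients are natural numbers by construction, so a verified expansion is
positive. -/
theorem gridCheck_eq_true (z : Bool) : gridCheck z = true := by
  revert z
  decide +kernel

theorem mem_contentTypes {x y z : ℕ} (h : 3 * x + 2 * y + z ≤ 9) :
    (x, y, z) ∈ contentTypes (3 * x + 2 * y + z) := by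
  simp only [contentTypes, List.mem_filterMap]
  refine ⟨(x, y), ?_, ?_⟩
  · rw [List.product, List.mem_flatMap]
    refine ⟨x, by simp; omega, ?_⟩
    simp
    omega
  · rw [if_pos (by simp only; omega)]
    simp only [Option.some.injEq, Prod.mk.injEq, true_and]
    omega

/-- The power series with the given expansion. -/
noncomputable def expansion (l : List Term) : MvPowerSeries ℕ+ ℤ :=
  (l.map fun p => (p.c : ℤ) • tripleElem (p.x + p.y + p.z + 1) (p.x + p.y + 1) (p.x + 1)).sum

theorem expansion_isEPositive (l : List Term) : IsEPositive (expansion l) := by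
  induction l with
  | nil => exact isEPositive_zero
  | cons p l ih =>
    rw [expansion, List.map_cons, List.sum_cons]
    exact ((tripleElem_isEPositive _ _ _).smul (Int.natCast_nonneg _)).add ih

theorem expansion_apply (l : List Term) (js : List ℕ+) (hjs : js.Nodup) (m : ℕ+ →₀ ℕ)
    (hm : ∀ j, j ∈ js ↔ m j ≠ 0) :
    expansion l m = ((l.map fun p => p.c * tripleCount (js.map m)
      (p.x + p.y + p.z + 1) (p.x + p.y + 1) (p.x + 1)).sum : ℕ) := by
  induction l with
  | nil => rfl
  | cons p l ih =>
    rw [List.map_cons, List.sum_cons, Nat.cast_add, ← ih, Nat.cast_mul,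
      ← tripleElem_apply js hjs m hm]
    rfl

theorem expansionCount_eq (x y z : ℕ) (l : List Term) :
    expansionCount x y z l = (l.map fun p => p.c * tripleCount
      (List.replicate x 3 ++ (List.replicate y 2 ++ List.replicate z 1))
      (p.x + p.y + p.z + 1) (p.x + p.y + 1) (p.x + 1)).sum := by
  induction l with
  | nil => rfl
  | cons p l ih =>
    rw [List.map_cons, List.sum_cons, ← ih, tripleCount_replicate]
    rfl

theorem count_gridGraph_of_four_le (z : Bool) (k : ℕ) (L : List ℕ) (S : Finset (Fin 3 × Fin 3)) :
    count (gridGraph z) ((k + 4) :: L) S = 0 := by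
  rw [count]
  refine Finset.sum_eq_zero fun I hI => ?_
  obtain ⟨-, h2, h3⟩ := mem_stable.1 hI
  obtain ⟨J, hJ, hJc⟩ := Finset.exists_subset_card_eq (show 4 ≤ I.card by omega)
  have : J ∈ stable (gridGraph z) 4 J :=
    mem_stable.2 ⟨subset_rfl, hJc, h3.mono (by exact_mod_cast hJ)⟩
  rw [(listsStable_four z).mem_iff] at this
  simp at this

/-- The verified expansion equals `X_G` coefficient by coefficient. Exponents of at least `4` give
zero on both sides; otherwise the variables can be sorted by exponent, and only the content `3^x 2^y
1^w` matters. -/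
theorem isEPositive_of_embedding_gridGraph {V : Type*} [Fintype V] [DecidableEq V]
    {G : SimpleGraph V} (z : Bool) (f : G ↪g gridGraph z) (hf : ∀ i, (i, 0) ∈ Set.range f) :
    IsEPositive (chromaticSymm G) := by
  obtain ⟨s, hs, hsS⟩ := exists_gridVerts (Finset.univ.map f.toEmbedding)
  have hcheck := List.all_eq_true.1 (gridCheck_eq_true z) s (by simpa using hs)
  -- `73 = 2^0 + 2^3 + 2^6` is the mask of the first column.
  have h73 : Nat.land 73 s = 73 := by
    rw [land_eq_iff (by norm_num), hsS]
    have : ∀ u ∈ gridVerts 73, u.2 = 0 := by decide +kernel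
    rintro ⟨i, p⟩ hu
    obtain rfl : p = 0 := this _ hu
    obtain ⟨v, hv⟩ := hf i
    rw [← hv]
    exact Finset.mem_map_of_mem f.toEmbedding (Finset.mem_univ v)
  rw [h73, Nat.beq_refl, cond_true, forced_eq] at hcheck
  obtain ⟨l, hl⟩ := exists_verifyExpansion hcheck
  rw [verifyExpansion, Bool.and_eq_true, List.all_eq_true, List.all_eq_true] at hl
  obtain ⟨hl1, hl2⟩ := hl
  have hle : (gridVerts s).card ≤ 9 := le_trans (Finset.card_le_univ _) (by simp)
  set n := (gridVerts s).card with hn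
  suffices h : chromaticSymm G = expansion l from h ▸ expansion_isEPositive l
  funext m
  by_cases hbig : ∃ j, 4 ≤ m j
  · obtain ⟨j, hj⟩ := hbig
    obtain ⟨k, hk⟩ : ∃ k, m j = k + 4 := ⟨m j - 4, by omega⟩
    have hjs : (j :: (m.support.erase j).toList).Nodup := by
      rw [List.nodup_cons]
      exact ⟨by simp, Finset.nodup_toList _⟩
    have hm : ∀ i, i ∈ j :: (m.support.erase j).toList ↔ m i ≠ 0 := by
      intro i
      by_cases hi : i = j
      · subst hi; simp [hk]
      · simp [hi]
    rw [chromaticSymm_apply G _ hjs m fun i => (hm i).2, expansion_apply l _ hjs m hm,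
      ← count_map f, List.map_cons, hk, count_gridGraph_of_four_le]
    simp [tripleCount]
  · push Not at hbig
    let part (k : ℕ) : List ℕ+ := (m.support.filter fun j => m j = k).toList
    have hpart : ∀ k j, j ∈ part k ↔ m j ≠ 0 ∧ m j = k := fun k j => by simp [part]
    have hjs : (part 3 ++ (part 2 ++ part 1)).Nodup := by
      simp only [List.nodup_append, List.mem_append, hpart]
      refine ⟨Finset.nodup_toList _, ⟨Finset.nodup_toList _, Finset.nodup_toList _, ?_⟩, ?_⟩
      · rintro i hi j hj rfl
        omega
      · rintro i hi j hj rfl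
        omega
    have hm : ∀ i, i ∈ part 3 ++ (part 2 ++ part 1) ↔ m i ≠ 0 := by
      intro i
      have := hbig i
      simp only [List.mem_append, hpart]
      omega
    have hmap : ∀ k, (part k).map m = List.replicate (part k).length k := fun k => by
      rw [List.eq_replicate_iff]
      refine ⟨by simp, fun x hx => ?_⟩
      obtain ⟨j, hj, rfl⟩ := List.mem_map.1 hx
      exact ((hpart k j).1 hj).2
    rw [chromaticSymm_apply G _ hjs m fun i => (hm i).2, expansion_apply l _ hjs m hm,
      ← count_map f, ← hsS]
    simp only [List.map_append, hmap]
    generalize (part 3).length = x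
    generalize (part 2).length = y
    generalize (part 1).length = w
    -- The check covers monomials of degree `n`; in any other degree both sides vanish by
    -- homogeneity.
    by_cases hsum : 3 * x + 2 * y + w = n
    · have h1 := hl2 _ (hsum ▸ mem_contentTypes (by omega))
      have h2 := Nat.eq_of_beq_eq_true h1
      rw [expansionCount_eq, maskCount_eq z (List.replicate x 3 ++ List.replicate y 2), List.append_assoc] at h2
      · exact_mod_cast h2
      · have hrep : ∀ (k : ℕ) (F : List ℕ) (i : ℕ), ListsStable z k F →
            List.Forall₂ (ListsStable z) (List.replicate i k) (List.replicate i F) := by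
          intro k F i h
          induction i with
          | zero => exact List.Forall₂.nil
          | succ i ih => exact List.Forall₂.cons h ih
        exact List.rel_append (hrep _ _ _ (listsStable_gridTriangles z))
          (hrep _ _ _ (listsStable_gridEdges z))
      · simp
        omega
    · rw [count_eq_zero_of_sum_ne _ (by simp; omega)]
      have : ∀ p ∈ l, p.c * tripleCount
          (List.replicate x 3 ++ (List.replicate y 2 ++ List.replicate w 1))
          (p.x + p.y + p.z + 1) (p.x + p.y + 1) (p.x + 1) = 0 := by
        intro p hp
        have := Nat.eq_of_beq_eq_true (hl1 p hp)
        rw [tripleCount_eq_zero (by simp; omega), mul_zero]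
      rw [List.map_congr_left this]
      simp

/-! ### The structure of the complement -/

section Structure

variable {V : Type*}

theorem InducedFree.not_forall_adj_iff {G : SimpleGraph V} {P : SimpleGraph (Fin 4)}
    (h : InducedFree G P) (f : Fin 4 → V) (hf : ∀ i j, i < j → f i ≠ f j)
    (hadj : ∀ i j, i < j → (G.Adj (f i) (f j) ↔ P.Adj i j)) : False := by
  refine h ⟨⟨⟨f, fun i j hij => ?_⟩, fun {i j} => ?_⟩⟩
  · by_contra hne
    rcases lt_or_gt_of_ne hne with h1 | h1
    · exact hf i j h1 hij
    · exact hf j i h1 hij.symm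
  · change G.Adj (f i) (f j) ↔ P.Adj i j
    rcases lt_trichotomy i j with h1 | rfl | h1
    · exact hadj i j h1
    · simp
    · rw [G.adj_comm, P.adj_comm]
      exact hadj j i h1

theorem forall_fin_four_lt {p : Fin 4 → Fin 4 → Prop} (h01 : p 0 1) (h02 : p 0 2) (h03 : p 0 3)
    (h12 : p 1 2) (h13 : p 1 3) (h23 : p 2 3) : ∀ i j, i < j → p i j := by
  intro i j hij
  fin_cases i <;> fin_cases j <;> first | assumption | exact absurd hij (by decide)

theorem compl_adj_or_of_claw_free {G : SimpleGraph V} (h : InducedFree G claw) {a b c d : V}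
    (hab : Gᶜ.Adj a b) (hac : Gᶜ.Adj a c) (hbc : Gᶜ.Adj b c) (hda : d ≠ a) (hdb : d ≠ b)
    (hdc : d ≠ c) : Gᶜ.Adj d a ∨ Gᶜ.Adj d b ∨ Gᶜ.Adj d c := by
  simp only [SimpleGraph.compl_adj] at *
  by_contra hcon
  refine h.not_forall_adj_iff ![d, a, b, c] (forall_fin_four_lt ?_ ?_ ?_ ?_ ?_ ?_)
    (forall_fin_four_lt ?_ ?_ ?_ ?_ ?_ ?_) <;> simp [claw] <;> tauto

theorem compl_adj_of_coDiamond_free {G : SimpleGraph V} (h : InducedFree G coDiamond)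
    {a b c d : V} (hab : Gᶜ.Adj a b) (hac : Gᶜ.Adj a c) (hbc : Gᶜ.Adj b c) (hda : Gᶜ.Adj d a)
    (hdb : Gᶜ.Adj d b) (hdc : d ≠ c) : Gᶜ.Adj d c := by
  simp only [SimpleGraph.compl_adj] at *
  by_contra hcon
  refine h.not_forall_adj_iff ![a, d, b, c] (forall_fin_four_lt ?_ ?_ ?_ ?_ ?_ ?_)
    (forall_fin_four_lt ?_ ?_ ?_ ?_ ?_ ?_) <;> simp [coDiamond, diamond, G.adj_comm] at * <;> tauto

/-- Otherwise `x`, `b`, `y`, `c` would induce a diamond in `G` with missing edge `bc`. -/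
theorem compl_adj_of_diamond_free {G : SimpleGraph V} (h : InducedFree G diamond)
    {b c x y : V} (hbc : Gᶜ.Adj b c) (hxy : x ≠ y) (hxb : x ≠ b) (hxc : x ≠ c) (hyb : y ≠ b)
    (hyc : y ≠ c) (hbx : ¬ Gᶜ.Adj b x) (hcx : ¬ Gᶜ.Adj c x) (hby : ¬ Gᶜ.Adj b y)
    (hcy : ¬ Gᶜ.Adj c y) : Gᶜ.Adj x y := by
  simp only [SimpleGraph.compl_adj] at *
  by_contra hcon
  refine h.not_forall_adj_iff ![x, b, y, c] (forall_fin_four_lt ?_ ?_ ?_ ?_ ?_ ?_)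
    (forall_fin_four_lt ?_ ?_ ?_ ?_ ?_ ?_) <;> simp [diamond, G.adj_comm] at * <;> tauto

/-- Otherwise `a` would be the centre of an induced claw in the complement, with leaves `b`, `x`,
`y`. -/
theorem compl_adj_of_coClaw_free {G : SimpleGraph V} (h : InducedFree G coClaw)
    {a b x y : V} (hab : Gᶜ.Adj a b) (hax : Gᶜ.Adj a x) (hay : Gᶜ.Adj a y) (hxy : x ≠ y)
    (hxb : x ≠ b) (hyb : y ≠ b) (hbx : ¬ Gᶜ.Adj b x) (hby : ¬ Gᶜ.Adj b y) : Gᶜ.Adj x y := by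
  simp only [SimpleGraph.compl_adj] at *
  by_contra hcon
  refine h.not_forall_adj_iff ![a, b, x, y] (forall_fin_four_lt ?_ ?_ ?_ ?_ ?_ ?_)
    (forall_fin_four_lt ?_ ?_ ?_ ?_ ?_ ?_) <;> simp [coClaw, claw] at * <;> tauto

/-- The properties of the complement of a graph in one of the two classes. -/
structure IsTriangleDominated (H : SimpleGraph V) : Prop where
  dominates : ∀ {a b c d : V}, H.Adj a b → H.Adj a c → H.Adj b c → d ≠ a → d ≠ b → d ≠ c →
    H.Adj d a ∨ H.Adj d b ∨ H.Adj d c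
  diamond_free : ∀ {a b c d : V}, H.Adj a b → H.Adj a c → H.Adj b c → H.Adj d a → H.Adj d b →
    d ≠ c → H.Adj d c
  private_adj : ∀ {a b c x y : V}, H.Adj a b → H.Adj a c → H.Adj b c → H.Adj a x → H.Adj a y →
    x ≠ y → x ≠ b → x ≠ c → y ≠ b → y ≠ c → ¬ H.Adj b x → ¬ H.Adj c x → ¬ H.Adj b y →
    ¬ H.Adj c y → H.Adj x y

theorem isTriangleDominated_compl {G : SimpleGraph V}
    (h : (InducedFree G claw ∧ InducedFree G coDiamond ∧ InducedFree G diamond) ∨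
      (InducedFree G claw ∧ InducedFree G coDiamond ∧ InducedFree G coClaw)) :
    IsTriangleDominated Gᶜ := by
  have h1 : InducedFree G claw := by tauto
  have h2 : InducedFree G coDiamond := by tauto
  refine ⟨compl_adj_or_of_claw_free h1, compl_adj_of_coDiamond_free h2, ?_⟩
  intro a b c x y hab hac hbc hax hay hxy hxb hxc hyb hyc hbx hcx hby hcy
  rcases h with ⟨-, -, h3⟩ | ⟨-, -, h3⟩
  · exact compl_adj_of_diamond_free h3 hbc hxy hxb hxc hyb hyc hbx hcx hby hcy
  · exact compl_adj_of_coClaw_free h3 hab hax hay hxy hxb hyb hbx hby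

/-- A vertex outside the clique has a neighbour in one of its triangles, then a second one in the
triangle avoiding the first, and hence, by diamond-freeness, is adjacent to all four. Two outside
vertices share the neighbours `a` and `b`, so they are adjacent as well. -/
theorem IsTriangleDominated.adj_of_four_clique {H : SimpleGraph V} (hH : IsTriangleDominated H)
    {a b c d : V} (hab : H.Adj a b) (hac : H.Adj a c) (had : H.Adj a d) (hbc : H.Adj b c)
    (hbd : H.Adj b d) (hcd : H.Adj c d) {u v : V} (huv : u ≠ v) : H.Adj u v := by
  have key : ∀ w, w ≠ a → w ≠ b → w ≠ c → w ≠ d →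
      H.Adj w a ∧ H.Adj w b ∧ H.Adj w c ∧ H.Adj w d := by
    intro w ha hb hc hd
    have two : ∀ {p q r s}, H.Adj p q → H.Adj p r → H.Adj p s → H.Adj q r → H.Adj q s →
        w ≠ r → w ≠ s → H.Adj w p → H.Adj w q → H.Adj w r ∧ H.Adj w s :=
      fun hpq hpr hps hqr hqs hr hs hp hq =>
        ⟨hH.diamond_free hpq hpr hqr hp hq hr, hH.diamond_free hpq hps hqs hp hq hs⟩
    have of_ab := two hab hac had hbc hbd hc hd
    have of_ac := two hac hab had hbc.symm hcd hb hd
    have of_ad := two had hab hac hbd.symm hcd.symm hb hc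
    have of_bc := two hbc hab.symm hbd hac.symm hcd ha hd
    have of_bd := two hbd hab.symm hbc had.symm hcd.symm ha hc
    have of_cd := two hcd hac.symm hbc.symm had.symm hbd.symm ha hb
    rcases hH.dominates hab hac hbc ha hb hc with h | h | h
    · rcases hH.dominates hbc hbd hcd hb hc hd with h' | h' | h'
      · exact ⟨h, h', of_ab h h'⟩
      · exact ⟨h, (of_ac h h').1, h', (of_ac h h').2⟩
      · exact ⟨h, (of_ad h h').1, (of_ad h h').2, h'⟩
    · rcases hH.dominates hac had hcd ha hc hd with h' | h' | h'
      · exact ⟨h', h, of_ab h' h⟩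
      · exact ⟨(of_bc h h').1, h, h', (of_bc h h').2⟩
      · exact ⟨(of_bd h h').1, h, (of_bd h h').2, h'⟩
    · rcases hH.dominates hab had hbd ha hb hd with h' | h' | h'
      · exact ⟨h', (of_ac h' h).1, h, (of_ac h' h).2⟩
      · exact ⟨(of_bc h' h).1, h', h, (of_bc h' h).2⟩
      · exact ⟨(of_cd h h').1, (of_cd h h').2, h, h'⟩
  have mem : ∀ w, w ≠ u → w ≠ a → w ≠ b → w ≠ c → w ≠ d → u ≠ a → u ≠ b → u ≠ c → u ≠ d →
      H.Adj u w := by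
    intro w hwu ha hb hc hd ha' hb' hc' hd'
    obtain ⟨h1, h2, -⟩ := key u ha' hb' hc' hd'
    obtain ⟨h3, h4, -⟩ := key w ha hb hc hd
    exact (hH.diamond_free hab h1.symm h2.symm h3 h4 hwu).symm
  have ku := key u
  have kv := key v
  by_cases hu : u ≠ a ∧ u ≠ b ∧ u ≠ c ∧ u ≠ d
  · obtain ⟨h1, h2, h3, h4⟩ := hu
    obtain ⟨g1, g2, g3, g4⟩ := ku h1 h2 h3 h4
    by_cases va : v = a
    · exact va ▸ g1
    by_cases vb : v = b
    · exact vb ▸ g2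
    by_cases vc : v = c
    · exact vc ▸ g3
    by_cases vd : v = d
    · exact vd ▸ g4
    exact mem v huv.symm va vb vc vd h1 h2 h3 h4
  · have hu' : u = a ∨ u = b ∨ u = c ∨ u = d := by
      by_contra h; push Not at h; exact hu h
    by_cases hv : v ≠ a ∧ v ≠ b ∧ v ≠ c ∧ v ≠ d
    · obtain ⟨h1, h2, h3, h4⟩ := hv
      obtain ⟨g1, g2, g3, g4⟩ := kv h1 h2 h3 h4
      rcases hu' with rfl | rfl | rfl | rfl
      exacts [g1.symm, g2.symm, g3.symm, g4.symm]
    · have hv' : v = a ∨ v = b ∨ v = c ∨ v = d := by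
        by_contra h; push Not at h; exact hv h
      rcases hu' with rfl | rfl | rfl | rfl <;> rcases hv' with rfl | rfl | rfl | rfl <;>
        first
        | exact absurd rfl huv
        | assumption
        | (apply SimpleGraph.Adj.symm; assumption)

/-- Domination gives at least one neighbour; a second would force a third by diamond-freeness, and
`hK` excludes three. -/
theorem IsTriangleDominated.exists_unique_adj {H : SimpleGraph V} (hH : IsTriangleDominated H)
    (hK : ∀ a b c d, H.Adj a b → H.Adj a c → H.Adj b c → H.Adj d a → H.Adj d b → ¬ H.Adj d c)
    {a b c d : V} (hab : H.Adj a b) (hac : H.Adj a c) (hbc : H.Adj b c) (hda : d ≠ a)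
    (hdb : d ≠ b) (hdc : d ≠ c) :
    (H.Adj d a ∧ ¬ H.Adj d b ∧ ¬ H.Adj d c) ∨ (¬ H.Adj d a ∧ H.Adj d b ∧ ¬ H.Adj d c) ∨
      (¬ H.Adj d a ∧ ¬ H.Adj d b ∧ H.Adj d c) := by
  have h1 := hH.dominates hab hac hbc hda hdb hdc
  have h2 := hK a b c d hab hac hbc
  have h3 := fun p q => hH.diamond_free hab hac hbc p q hdc
  have h4 := fun p q => hH.diamond_free hac hab hbc.symm p q hdb
  have h5 := fun p q => hH.diamond_free hbc hab.symm hac.symm p q hda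
  tauto

/-- The row of a vertex is the triangle vertex that it equals or is adjacent to. Column `0` holds
the triangle, and a sign separates the at most two other vertices of a row. Two rows that both have
outside vertices are joined by a straight or twisted matching; signs can be chosen to straighten
those at row `0`, so only the twist between rows `1` and `2` remains. -/
theorem exists_grid_labelling {H : SimpleGraph V} (hH : IsTriangleDominated H)
    (hK : ∀ a b c d, H.Adj a b → H.Adj a c → H.Adj b c → H.Adj d a → H.Adj d b → ¬ H.Adj d c)
    (t : Fin 3 → V) (ht : ∀ i j, i ≠ j → H.Adj (t i) (t j)) :
    ∃ (z : Bool) (f : V → Fin 3 × Fin 3), Function.Injective f ∧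
      (∀ u v, u ≠ v → (H.Adj u v ↔ gridRel z (f u) (f v) = true)) ∧ ∀ i, (i, 0) ∈ Set.range f := by
  classical
  let O : V → Prop := fun v => ∀ k, v ≠ t k
  have hex : ∀ v, ∃ i, (¬ O v → v = t i) ∧ (O v → ∀ k, H.Adj v (t k) ↔ k = i) := by
    intro v
    by_cases hv : O v
    · rcases hH.exists_unique_adj hK (ht 0 1 (by decide)) (ht 0 2 (by decide))
        (ht 1 2 (by decide)) (hv 0) (hv 1) (hv 2) with h | h | h
      · exact ⟨0, fun h' => absurd hv h', fun _ k => by fin_cases k <;> simp [h]⟩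
      · exact ⟨1, fun h' => absurd hv h', fun _ k => by fin_cases k <;> simp [h]⟩
      · exact ⟨2, fun h' => absurd hv h', fun _ k => by fin_cases k <;> simp [h]⟩
    · have : ∃ i, v = t i := by simpa [O] using hv
      obtain ⟨i, hi⟩ := this
      exact ⟨i, fun _ => hi, fun h => absurd h hv⟩
  choose idx hT hO using hex
  have tinj : ∀ i j, t i = t j → i = j := fun i j h => by
    by_contra hne
    exact (ht i j hne).ne h
  have hOt : ∀ i, ¬ O (t i) := fun i h => h i rfl
  have idx_t : ∀ i, idx (t i) = i := fun i => (tinj _ _ (hT _ (hOt i))).symm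
  have row : ∀ x y, O x → O y → x ≠ y → idx x = idx y → H.Adj x y := by
    intro x y hx hy hxy hi
    have hj : ∃ j k : Fin 3, idx x ≠ j ∧ idx x ≠ k ∧ j ≠ k := by
      generalize idx x = i
      revert i
      decide
    obtain ⟨j, k, hj, hk, hjk⟩ := hj
    have hne : ∀ w, O w → ∀ l, idx w ≠ l → ¬ H.Adj (t l) w := fun w hw l hl h =>
      hl ((hO w hw l).1 h.symm).symm
    exact hH.private_adj (ht _ _ hj) (ht _ _ hk) (ht _ _ hjk) ((hO x hx _).2 rfl).symm
      (hi ▸ ((hO y hy _).2 rfl).symm) hxy (hx j) (hx k) (hy j) (hy k) (hne x hx j hj)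
      (hne x hx k hk) (hne y hy j (hi ▸ hj)) (hne y hy k (hi ▸ hk))
  have row3 : ∀ x y w, O x → O y → O w → idx x = idx y → idx x = idx w → x ≠ y → x ≠ w → y ≠ w →
      False := by
    intro x y w hx hy hw h1 h2 hxy hxw hyw
    exact hK x y w (t (idx x)) (row x y hx hy hxy h1) (row x w hx hw hxw h2)
      (row y w hy hw hyw (h1 ▸ h2)) ((hO x hx _).2 rfl).symm ((hO y hy _).2 h1).symm
      ((hO w hw _).2 h2).symm
  -- If `x` and `y` share a row, they form a triangle with the triangle vertex of that row. Since
  -- `u` lies in another row it misses this vertex, so it sees exactly one of `x` and `y`.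
  have cross : ∀ x y u, O x → O y → O u → idx x = idx y → idx x ≠ idx u → x ≠ y →
      (H.Adj u x ↔ ¬ H.Adj u y) := by
    intro x y u hx hy hu h1 h2 hxy
    have h3 : ¬ H.Adj u (t (idx x)) := fun h => h2 ((hO u hu _).1 h)
    have h4 : u ≠ x := fun h => h2 (h ▸ rfl)
    have h5 : u ≠ y := fun h => h2 (h ▸ h1)
    have := hH.exists_unique_adj hK ((hO x hx _).2 rfl).symm ((hO y hy _).2 h1).symm
      (row x y hx hy hxy h1) (hu _) h4 h5
    tauto
  -- A reference vertex for each row that has an outside vertex; for other rows the value `t 0` is a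
  -- dummy.
  have hr : ∀ i, ∃ r, ∀ x, O x → idx x = i → O r ∧ idx r = i := by
    intro i
    by_cases h : ∃ x, O x ∧ idx x = i
    · obtain ⟨r, hr⟩ := h
      exact ⟨r, fun _ _ _ => hr⟩
    · exact ⟨t 0, fun x h1 h2 => absurd ⟨x, h1, h2⟩ h⟩
  choose r hr using hr
  obtain ⟨sgn, sgn_row, sgn_cross⟩ : ∃ sgn : V → Prop,
      (∀ x y, O x → O y → x ≠ y → idx x = idx y → (sgn x ↔ ¬ sgn y)) ∧
      ∀ x u, O x → O u → idx x = 0 → idx u ≠ 0 → (H.Adj x u ↔ (sgn x ↔ sgn u)) := by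
    -- Being the reference vertex is the sign within row `0`; the other rows copy it through
    -- adjacency to `r 0`. If row `0` has no outside vertex, each row may choose its own reference.
    refine ⟨fun v => if idx v ≠ 0 ∧ ∃ x, O x ∧ idx x = 0 then H.Adj v (r 0) else v = r (idx v),
      ?_, ?_⟩
    · intro x y hx hy hxy hi
      simp only [hi]
      split_ifs with h
      · obtain ⟨h1, w, hw, hw0⟩ := h
        obtain ⟨hr1, hr2⟩ := hr 0 w hw hw0
        rw [H.adj_comm x, H.adj_comm y]
        exact cross x y (r 0) hx hy hr1 hi (by rw [hr2, hi]; exact h1) hxy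
      · obtain ⟨hr1, hr2⟩ := hr (idx y) y hy rfl
        constructor
        · rintro h1 h2
          exact hxy (h1.trans h2.symm)
        · intro h1
          by_contra h2
          exact row3 x y (r (idx y)) hx hy hr1 hi (hi.trans hr2.symm) hxy h2 h1
    · intro x u hx hu hx0 hu0
      obtain ⟨hr1, hr2⟩ := hr 0 x hx hx0
      simp only [hx0]
      rw [if_neg (by simp), if_pos ⟨hu0, x, hx, hx0⟩]
      by_cases h : x = r 0
      · subst h
        rw [H.adj_comm]
        simp
      · have := cross x (r 0) u hx hr1 hu (hx0.trans hr2.symm) (by rw [hx0]; exact hu0.symm) h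
        rw [H.adj_comm x, this]
        simp [h]
  obtain ⟨z, hz⟩ : ∃ z : Bool, ∀ x u, O x → O u → idx x = 1 → idx u = 2 →
      (H.Adj x u ↔ ((sgn x ↔ sgn u) ↔ ¬ z = true)) := by
    by_cases h : (∃ x, O x ∧ idx x = 1) ∧ ∃ u, O u ∧ idx u = 2
    · obtain ⟨⟨x₀, hx₀, hx1⟩, u₀, hu₀, hu2⟩ := h
      refine ⟨decide (¬ (H.Adj x₀ u₀ ↔ (sgn x₀ ↔ sgn u₀))), fun x u hx hu hx' hu' => ?_⟩
      -- Replacing a vertex by the other one of its row flips both the adjacency and the sign, so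
      -- the twist read off at `x₀`, `u₀` is valid for all pairs.
      have h1 : x = x₀ ∨ ((H.Adj u x ↔ ¬ H.Adj u x₀) ∧ (sgn x ↔ ¬ sgn x₀)) := by
        by_cases h : x = x₀
        · exact Or.inl h
        · exact Or.inr ⟨cross x x₀ u hx hx₀ hu (hx'.trans hx1.symm) (by rw [hx', hu']; decide) h,
            sgn_row x x₀ hx hx₀ h (hx'.trans hx1.symm)⟩
      have h2 : u = u₀ ∨ ((H.Adj x₀ u ↔ ¬ H.Adj x₀ u₀) ∧ (sgn u ↔ ¬ sgn u₀)) := by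
        by_cases h : u = u₀
        · exact Or.inl h
        · exact Or.inr ⟨cross u u₀ x₀ hu hu₀ hx₀ (hu'.trans hu2.symm) (by rw [hu', hx1]; decide) h,
            sgn_row u u₀ hu hu₀ h (hu'.trans hu2.symm)⟩
      rw [H.adj_comm u, H.adj_comm u] at h1
      rw [decide_eq_true_iff]
      rcases h1 with rfl | ⟨h1, h1'⟩ <;> rcases h2 with rfl | ⟨h2, h2'⟩ <;> tauto
    · exact ⟨false, fun x u hx hu hx' hu' => absurd ⟨⟨x, hx, hx'⟩, u, hu, hu'⟩ h⟩
  let lab : V → Fin 3 := fun v => if O v then (if sgn v then 1 else 2) else 0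
  have lab_zero : ∀ v, lab v = 0 ↔ ¬ O v := by
    intro v
    by_cases hv : O v
    · by_cases hs : sgn v
      · simp only [lab, if_pos hv, if_pos hs]
        exact iff_of_false (by decide) (not_not.2 hv)
      · simp only [lab, if_pos hv, if_neg hs]
        exact iff_of_false (by decide) (not_not.2 hv)
    · simp only [lab, if_neg hv]
      exact iff_of_true trivial hv
  have lab_eq : ∀ u v, O u → O v → (lab u = lab v ↔ (sgn u ↔ sgn v)) := by
    intro u v hu hv
    simp only [lab, if_pos hu, if_pos hv]
    by_cases h1 : sgn u <;> by_cases h2 : sgn v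
    · simp only [if_pos h2, iff_of_true h1 h2]
    · simp only [if_pos h1, if_neg h2]
      exact iff_of_false (by decide) (by tauto)
    · simp only [if_neg h1, if_pos h2]
      exact iff_of_false (by decide) (by tauto)
    · simp only [if_neg h2, iff_of_false h1 h2]
  have hinj : ∀ u v, idx u = idx v → lab u = lab v → u = v := by
    intro u v h1 h2
    by_cases hu : O u
    · by_cases hv : O v
      · by_contra hne
        have := sgn_row u v hu hv hne h1
        rw [lab_eq u v hu hv] at h2
        tauto
      · rw [(lab_zero v).2 hv, lab_zero] at h2
        exact absurd hu h2
    · have hv : ¬ O v := by rwa [← lab_zero, ← h2, lab_zero]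
      rw [hT u hu, hT v hv, h1]
  refine ⟨z, fun v => (idx v, lab v), fun u v h => ?_, fun u v huv => ?_, fun i => ?_⟩
  · rw [Prod.mk.injEq] at h
    exact hinj u v h.1 h.2
  · simp only [gridRel]
    by_cases hi : idx u = idx v
    · have hl : lab u ≠ lab v := fun h => huv (hinj u v hi h)
      simp only [hi, if_true, hl, ne_eq, not_false_eq_true, decide_true, iff_true]
      by_cases hu : O u <;> by_cases hv : O v
      · exact row u v hu hv huv hi
      · rw [hT v hv]
        exact (hO u hu _).2 hi.symm
      · rw [hT u hu]
        exact ((hO v hv _).2 hi).symm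
      · exact absurd (by rw [hT u hu, hT v hv, hi]) huv
    · rw [if_neg hi]
      by_cases hu : O u <;> by_cases hv : O v
      · have hu0 : lab u ≠ 0 := fun h => (lab_zero u).1 h hu
        have hv0 : lab v ≠ 0 := fun h => (lab_zero v).1 h hv
        simp only [hu0, hv0, false_or]
        by_cases hu1 : idx u = 0
        · rw [if_pos (Or.inl hu1), decide_eq_true_iff, lab_eq u v hu hv]
          exact sgn_cross u v hu hv hu1 fun h => hi (hu1.trans h.symm)
        by_cases hv1 : idx v = 0
        · rw [if_pos (Or.inr hv1), decide_eq_true_iff, lab_eq u v hu hv, H.adj_comm, iff_comm (a := sgn u)]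
          exact sgn_cross v u hv hu hv1 hu1
        rw [if_neg (by tauto)]
        have hcase : (idx u = 1 ∧ idx v = 2) ∨ (idx v = 1 ∧ idx u = 2) := by omega
        have hx : (xor z (decide (lab u = lab v))) = true ↔
            ((sgn u ↔ sgn v) ↔ ¬ z = true) := by
          rw [← lab_eq u v hu hv]
          cases z <;> simp
        rw [hx]
        rcases hcase with ⟨h1, h2⟩ | ⟨h1, h2⟩
        · exact hz u v hu hv h1 h2
        · rw [H.adj_comm, iff_comm (a := sgn u)]
          exact hz v u hv hu h1 h2
      · have hu0 : lab u ≠ 0 := fun h => (lab_zero u).1 h hu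
        have hv0 := (lab_zero v).2 hv
        rw [if_pos (Or.inr (Or.inl hv0)), decide_eq_true_iff, hv0]
        refine iff_of_false (fun h => ?_) hu0
        rw [hT v hv] at h
        exact hi ((hO u hu _).1 h).symm
      · have hv0 : lab v ≠ 0 := fun h => (lab_zero v).1 h hv
        have hu0 := (lab_zero u).2 hu
        rw [if_pos (Or.inl hu0), decide_eq_true_iff, hu0]
        refine iff_of_false (fun h => ?_) hv0.symm
        rw [hT u hu] at h
        exact hi ((hO v hv _).1 h.symm)
      · have hu0 := (lab_zero u).2 hu
        have hv0 := (lab_zero v).2 hv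
        rw [if_pos (Or.inl hu0), decide_eq_true_iff, hu0, hv0, hT u hu, hT v hv]
        exact iff_of_true (ht _ _ hi) rfl
  · exact ⟨t i, Prod.ext (idx_t i) ((lab_zero _).2 (hOt i))⟩

theorem isEPositive_of_isTriangleDominated_compl [Fintype V] {G : SimpleGraph V}
    (hG : IsTriangleDominated Gᶜ) : IsEPositive (chromaticSymm G) := by
  classical
  by_cases hK : ∃ a b c d, Gᶜ.Adj a b ∧ Gᶜ.Adj a c ∧ Gᶜ.Adj b c ∧ Gᶜ.Adj d a ∧ Gᶜ.Adj d b ∧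
      Gᶜ.Adj d c
  · obtain ⟨a, b, c, d, hab, hac, hbc, hda, hdb, hdc⟩ := hK
    refine isEPositive_of_edgeless fun u v huv => ?_
    have := hG.adj_of_four_clique hab hac hda.symm hbc hdb.symm hdc.symm huv.ne
    exact ((SimpleGraph.compl_adj _ _ _).1 this).2 huv
  by_cases hT : ∃ a b c, Gᶜ.Adj a b ∧ Gᶜ.Adj a c ∧ Gᶜ.Adj b c
  · obtain ⟨a, b, c, hab, hac, hbc⟩ := hT
    have hK' : ∀ a b c d, Gᶜ.Adj a b → Gᶜ.Adj a c → Gᶜ.Adj b c → Gᶜ.Adj d a → Gᶜ.Adj d b →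
        ¬ Gᶜ.Adj d c := fun a b c d h1 h2 h3 h4 h5 h6 => hK ⟨a, b, c, d, h1, h2, h3, h4, h5, h6⟩
    obtain ⟨z, f, hinj, hadj, hrange⟩ := exists_grid_labelling hG hK' ![a, b, c] (by
      intro i j hij
      fin_cases i <;> fin_cases j <;>
        first
        | exact absurd rfl hij
        | assumption
        | (apply SimpleGraph.Adj.symm; assumption))
    refine isEPositive_of_embedding_gridGraph z ⟨⟨f, hinj⟩, fun {u v} => ?_⟩ hrange
    change (f u ≠ f v ∧ gridRel z (f u) (f v) = false) ↔ G.Adj u v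
    by_cases huv : u = v
    · simp [huv]
    · have h1 := hadj u v huv
      rw [SimpleGraph.compl_adj] at h1
      rw [← Bool.not_eq_true, ← h1]
      have h2 : f u ≠ f v := hinj.ne huv
      tauto
  · refine isEPositive_of_stable_three_eq_empty fun S k hk =>
      Finset.eq_empty_of_forall_notMem fun I hI => hT ?_
    obtain ⟨-, h2, h3⟩ := mem_stable.1 hI
    obtain ⟨J, hJ, hJc⟩ := Finset.exists_subset_card_eq (show 3 ≤ I.card by omega)
    obtain ⟨a, b, c, hab, hac, hbc, rfl⟩ := Finset.card_eq_three.1 hJc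
    have h4 : G.IsIndepSet (({a, b, c} : Finset V) : Set V) := h3.mono (by exact_mod_cast hJ)
    simp only [SimpleGraph.compl_adj]
    exact ⟨a, b, c, ⟨hab, h4 (by simp) (by simp) hab⟩, ⟨hac, h4 (by simp) (by simp) hac⟩,
      hbc, h4 (by simp) (by simp) hbc⟩

end Structure

end ChromSymm

theorem mainTheorem3 {V : Type*} [Fintype V] (G : SimpleGraph V)
    (h : (ChromSymm.InducedFree G ChromSymm.claw ∧
          ChromSymm.InducedFree G ChromSymm.coDiamond ∧
          ChromSymm.InducedFree G ChromSymm.diamond) ∨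
        (ChromSymm.InducedFree G ChromSymm.claw ∧
          ChromSymm.InducedFree G ChromSymm.coDiamond ∧
          ChromSymm.InducedFree G ChromSymm.coClaw)) :
    ChromSymm.IsEPositive (ChromSymm.chromaticSymm G) :=
  ChromSymm.isEPositive_of_isTriangleDominated_compl (ChromSymm.isTriangleDominated_compl h)
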